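/- Theorem 4.2. For each $k\in\mathbb N$ let $0<p_k<1$ and $q_k:=1-p_k$. Let $\Omega:=\{-1,+1\}^{\mathbb N}$ carry the product $\sigma$-algebra and the probability measure $P:=\bigotimes_{k\in\mathbb N}(p_k\delta_{+1}+q_k\delta_{-1})$, with expectation $\mathbb E$, so that the coordinates are independent Rademacher random variables with success probabilities $p_k$. For $F:\Omega\to\mathbb R$ define the discrete gradient $$D_kF:=\sqrt{p_kq_k}\,(F_k^+-F_k^-),\qquad F_k^{\pm}(\omega):=F(\omega_1,\ldots,\omega_{k-1},\pm1,\omega_{k+1},\ldots),$$ and write $F\in\mathrm{dom}(D)$ if $F\in L^2(\Omega)$ and $\mathbb E\big[\sum_{k}(D_kF)^2\big]<\infty$. Let $d_K(X,Y):=\sup_{x\in\mathbb R}|P(X\le x)-P(Y\le x)|$ denote the Kolmogorov distance. Let $F\in\mathrm{dom}(D)$ with $\mathbb E[F]=0$ and $\mathbb E[F^2]=1$, let $N$ be a standard Gaussian random variable, and let $r,s,t\in(1,\infty)$ satisfy $\frac1r+\frac1s+\frac1t=1$. Then, where all expectations and sums on the right-hand side are taken in $[0,\infty]$ (with $0\cdot\infty=0$),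 $$\begin{aligned} d_K(F,N)\le{}&\Big(\tfrac{15}{4}\sum_{j,k,\ell=1}^\infty\big(\mathbb E[(D_jF)^2(D_kF)^2]\big)^{1/2}\big(\mathbb E[(D_\ell D_jF)^2(D_\ell D_kF)^2]\big)^{1/2}\Big)^{1/2}\\ &+\Big(\tfrac34\sum_{j,k,\ell=1}^\infty\frac1{p_\ell q_\ell}\,\mathbb E[(D_\ell D_jF)^2(D_\ell D_kF)^2]\Big)^{1/2} +\frac{\sqrt{2\pi}}8\sum_{k=1}^\infty\frac1{\sqrt{p_kq_k}}\,\mathbb E[|D_kF|^3]\\ &+\tfrac12\big(\mathbb E[|F|^r]\big)^{1/r}\sum_{k=1}^\infty\frac1{\sqrt{p_kq_k}}\big(\mathbb E[|D_kF|^{2s}]\big)^{1/s}\big(\mathbb E[|D_kF|^t]\big)^{1/t}\\ &+\Big(\sum_{k=1}^\infty\frac1{p_kq_k}\,\mathbb E[(D_kF)^4]\Big)^{1/2} +\Big(6\sum_{k,\ell=1}^\infty\frac1{p_kq_k}\big(\mathbb E[(D_kF)^4]\big)^{1/2}\big(\mathbb E[(D_\ell D_kF)^4]\big)^{1/2}\Big)^{1/2}\\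 &+\Big(3\sum_{k,\ell=1}^\infty\frac1{p_kq_kp_\ell q_\ell}\,\mathbb E[(D_\ell D_kF)^4]\Big)^{1/2}. \end{aligned}$$ -/

import Mathlib

open MeasureTheory ProbabilityTheory
open scoped ENNReal unitInterval

noncomputable section

namespace Rademacher

/-- The path space `{-1, +1}^ℕ`. The group `ℤˣ` of units of `ℤ` is the two-point set `{1, -1}`
(with the discrete σ-algebra); the space carries the product σ-algebra. -/
abbrev PathSpace : Type := ℕ → ℤˣ

/-- The σ-algebra of `ℤˣ` is its power set. -/
instance : DiscreteMeasurableSpace ℤˣ where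
  forall_measurableSet s :=
    ⟨Units.val '' s, .of_discrete, Set.preimage_image_eq s Units.val_injective⟩

/-- The product measure `⨂ k, (p k δ_{+1} + (1 - p k) δ_{-1})` on the path space: under it the
coordinates are independent, equal to `+1` with probability `p k` and to `-1` with probability
`q k = 1 - p k`. -/
def law (p : ℕ → I) : Measure PathSpace :=
  Measure.infinitePi fun k => bernoulliMeasure (1 : ℤˣ) (-1) (p k)

/-- The product `p_k q_k`, where `q_k = 1 - p_k`. -/
def pq (p : ℕ → I) (k : ℕ) : ℝ := (p k : ℝ) * (1 - (p k : ℝ))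

/-- The discrete gradient `D_k F = √(p_k q_k) (F_k^+ - F_k^-)`, where `F_k^±` is `F` evaluated at
the path whose `k`-th coordinate has been replaced by `±1`. -/
def D (p : ℕ → I) (k : ℕ) (F : PathSpace → ℝ) : PathSpace → ℝ := fun ω =>
  √(pq p k) * (F (Function.update ω k 1) - F (Function.update ω k (-1)))

/-- Expectation of a non-negative random variable, with values in `[0, ∞]`. -/
def expect (p : ℕ → I) (G : PathSpace → ℝ) : ℝ≥0∞ := ∫⁻ ω, ENNReal.ofReal (G ω) ∂(law p)

/-- `F ∈ dom(D)`: the functional `F` is square-integrable and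
`E[‖DF‖²_{ℓ²(ℕ)}] = E[∑_k (D_k F)²]` is finite. -/
def MemDomD (p : ℕ → I) (F : PathSpace → ℝ) : Prop :=
  MemLp F 2 (law p) ∧ ∫⁻ ω, ∑' k, ENNReal.ofReal (D p k F ω ^ 2) ∂(law p) < ∞

end Rademacher

/-- The Kolmogorov distance `sup_x |P(X ≤ x) - P(Y ≤ x)|` of two real random variables, which may
be defined on different probability spaces. -/
def kolmogorovDist {Ω Ω' : Type*} [MeasurableSpace Ω] [MeasurableSpace Ω']
    (X : Ω → ℝ) (μ : Measure Ω) (Y : Ω' → ℝ) (ν : Measure Ω') : ℝ :=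
  ⨆ x : ℝ, |μ.real {ω | X ω ≤ x} - ν.real {ω | Y ω ≤ x}|

end

open Rademacher

/-! The argument is the Malliavin–Stein method, carried out for finitely many coordinates, where
every functional is bounded, and then passed to the limit.

Fix a finite set `N` and put `G = condE p N F`. Draw `u` uniformly from [0, 1] and keep each
coordinate of `N` independently with probability `u`; the retained set then equals a given `S` with
probability ∫ u^s (1-u)^(n-s) du = `cardWeight n s`. Averaging `condE p S (D p k F)` over this
random set is Mehler's formula for -D_k L⁻¹, which gives `dInv`. No semigroup is needed: the
covariance identity `covariance_eq` follows because the weights make insertion increments telescope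
(`sum_weight_mul_sub`) and each increment is `Y p k` times an averaged gradient
(`condE_insert_sub_erase`).

Put the solution of Stein's equation into this identity. It is bounded by √(2π)/4 and its derivative
by 1, so two errors remain. One is E|1 - Z| with Z = ∑ D_k G · `dInv`, which splits into a variance
defect and a fluctuation controlled by the Poincaré inequality `variance_le`. The other is a Taylor
remainder. Its smooth part gives the two third-order terms. Its jump part is a product of increments
of `G` and of a monotone indicator of `G`; this product is nonnegative, so the absolute value
disappears, and integration by parts moves the gradient off the indicator. What is left is the norm
of a Skorohod integral, bounded in `integral_sq_sum_Y_mul_le`.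

Jensen's inequality bounds the moments of `condE` and `dInv` by those of the gradients of `F`. The
product rule has three summands, whence a factor 3; a coordinate lies in the random set with
probability 1/2, whence a factor 1/4 wherever the gradient falls on `dInv`. This produces 15/4 = 3(1
+ 1/4) and 3/4. Martingale convergence along `Finset.Iic n` and continuity of the normal
distribution function conclude. -/

noncomputable section

namespace Rademacher

open Function

variable {p : ℕ → I}

/-! ### The law of the coordinates -/

instance : IsProbabilityMeasure (law p) := by unfold law; infer_instance

lemma pq_pos (hp : ∀ k, 0 < p k ∧ p k < 1) (k : ℕ) : 0 < pq p k :=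
  mul_pos (hp k).1 (sub_pos.2 (hp k).2)

lemma measurable_piecewise (S : Finset ℕ) :
    Measurable fun z : PathSpace × PathSpace => S.piecewise z.1 z.2 := by
  refine measurable_pi_lambda _ fun i => ?_
  by_cases hi : i ∈ S
  · simp only [Finset.piecewise, hi, if_true]; fun_prop
  · simp only [Finset.piecewise, hi, if_false]; fun_prop

/-- Resampling the coordinates outside `S` preserves the law. -/
lemma measurePreserving_piecewise (S : Finset ℕ) :
    MeasurePreserving (fun z : PathSpace × PathSpace => S.piecewise z.1 z.2)
      ((law p).prod (law p)) (law p) where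
  measurable := measurable_piecewise S
  map_eq := by
    refine Measure.eq_infinitePi _ fun s t ht => ?_
    rw [Measure.map_apply (measurable_piecewise S)
      (MeasurableSet.pi s.countable_toSet fun i _ => ht i)]
    have : (fun z : PathSpace × PathSpace => S.piecewise z.1 z.2) ⁻¹' Set.pi s t =
        (Set.pi (s.filter (· ∈ S) : Finset ℕ) t) ×ˢ (Set.pi (s.filter (· ∉ S) : Finset ℕ) t) := by
      ext z
      simp only [Set.mem_preimage, Set.mem_pi, Set.mem_prod, Finset.mem_coe, Finset.mem_filter,
        Finset.piecewise]
      refine ⟨fun h => ⟨fun i hi => by simpa [hi.2] using h i hi.1,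
        fun i hi => by simpa [hi.2] using h i hi.1⟩, fun h i hi => ?_⟩
      split_ifs with hS
      exacts [h.1 i ⟨hi, hS⟩, h.2 i ⟨hi, hS⟩]
    rw [this, Measure.prod_prod, law, Measure.infinitePi_pi _ fun i _ => ht i,
      Measure.infinitePi_pi _ fun i _ => ht i, Finset.prod_filter_mul_prod_filter_not]

lemma measurable_update_const (k : ℕ) (x : ℤˣ) :
    Measurable fun ω : PathSpace => update ω k x :=
  measurable_pi_lambda _ fun i => by
    by_cases hi : i = k
    · subst hi; simp
    · simpa [hi] using measurable_pi_apply i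

/-- Resampling coordinate `k` from an independent copy preserves the law, and the fresh coordinate
has only two values. This disintegration underlies every later computation with `update`. -/
lemma law_eq_smul_map_add (k : ℕ) :
    law p = ENNReal.ofReal (p k) • (law p).map (fun ω => update ω k 1) +
      ENNReal.ofReal (1 - p k) • (law p).map (fun ω => update ω k (-1)) := by
  ext A hA
  have h1 : law p A = ∫⁻ ω, ∫⁻ ω', A.indicator 1 (update ω k (ω' k)) ∂law p ∂law p := by
    have hm := (measurePreserving_piecewise (p := p) {k}).comp
      (Measure.measurePreserving_swap (μ := law p) (ν := law p))
    rw [← lintegral_indicator_one hA, ← hm.lintegral_comp (measurable_one.indicator hA),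
      lintegral_prod (fun z => A.indicator 1 _)
        ((measurable_one.indicator hA).comp hm.measurable).aemeasurable]
    simp [Finset.piecewise_singleton]
  have h2 (ω : PathSpace) : ∫⁻ ω', A.indicator 1 (update ω k (ω' k)) ∂law p =
      ENNReal.ofReal (p k) * A.indicator 1 (update ω k 1) +
      ENNReal.ofReal (1 - p k) * A.indicator 1 (update ω k (-1)) := by
    have := (measurePreserving_eval_infinitePi
      (fun k => bernoulliMeasure (1 : ℤˣ) (-1) (p k)) k).lintegral_comp
      (f := fun x => A.indicator 1 (update ω k x)) .of_discrete
    rw [law]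
    refine this.trans ?_
    rw [bernoulliMeasure_def, lintegral_add_measure, lintegral_smul_measure,
      lintegral_smul_measure, lintegral_dirac, lintegral_dirac]
    congr 2
    · simp [← unitInterval.coe_toNNReal]
    · rw [show (1 - (p k : ℝ)) = ((σ (p k) : I) : ℝ) from rfl, ← unitInterval.coe_toNNReal,
        Real.toNNReal_coe]
  have h3 (x : ℤˣ) : Measurable fun ω : PathSpace => A.indicator (1 : PathSpace → ℝ≥0∞)
      (update ω k x) := (measurable_one.indicator hA).comp (measurable_update_const k x)
  have h4 (x : ℤˣ) : ∫⁻ ω, A.indicator 1 (update ω k x) ∂law p =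
      (law p).map (fun ω => update ω k x) A := by
    rw [← lintegral_indicator_one hA,
      lintegral_map (measurable_one.indicator hA) (measurable_update_const k x)]
  rw [h1]
  simp_rw [h2]
  rw [lintegral_add_left ((h3 _).const_mul _), lintegral_const_mul _ (h3 _),
    lintegral_const_mul _ (h3 _), h4, h4]
  simp

/-- Both atoms of each coordinate have positive mass, so forcing a coordinate cannot charge a null
set. Hence the gradient is well defined on almost-everywhere classes. -/
lemma quasiMeasurePreserving_update (hp : ∀ k, 0 < p k ∧ p k < 1) (k : ℕ) (x : ℤˣ) :
    Measure.QuasiMeasurePreserving (fun ω => update ω k x) (law p) (law p) where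
  measurable := measurable_update_const k x
  absolutelyContinuous := by
    have h1 : ENNReal.ofReal (p k) ≠ 0 := by simpa using (hp k).1
    have h2 : ENNReal.ofReal (1 - p k) ≠ 0 := by simpa using (hp k).2
    intro s hs
    rw [law_eq_smul_map_add k] at hs
    simp only [Measure.coe_add, Pi.add_apply, add_eq_zero, Measure.smul_apply, smul_eq_mul,
      mul_eq_zero, h1, h2, false_or] at hs
    rcases Int.units_eq_one_or x with rfl | rfl
    exacts [hs.1, hs.2]

lemma _root_.MeasureTheory.Integrable.comp_update (hp : ∀ k, 0 < p k ∧ p k < 1)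
    {F : PathSpace → ℝ} (hF : Integrable F (law p)) (k : ℕ) (x : ℤˣ) :
    Integrable (fun ω => F (update ω k x)) (law p) := by
  have h1 : ENNReal.ofReal (p k) ≠ 0 := by simpa using (hp k).1
  have h2 : ENNReal.ofReal (1 - p k) ≠ 0 := by simpa using (hp k).2
  rw [law_eq_smul_map_add k, integrable_add_measure, integrable_smul_measure h1 (by simp),
    integrable_smul_measure h2 (by simp)] at hF
  have : Integrable F ((law p).map (fun ω => update ω k x)) := by
    rcases Int.units_eq_one_or x with rfl | rfl
    exacts [hF.1, hF.2]
  exact this.comp_measurable (measurable_update_const k x)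

lemma integral_law_eq {F : PathSpace → ℝ} (hF : Integrable F (law p)) (k : ℕ) :
    ∫ ω, F ω ∂law p = p k * ∫ ω, F (update ω k 1) ∂law p +
      (1 - p k) * ∫ ω, F (update ω k (-1)) ∂law p := by
  have hF' := hF
  rw [law_eq_smul_map_add k, integrable_add_measure] at hF'
  conv_lhs => rw [law_eq_smul_map_add k]
  have hm (x : ℤˣ) (c : ℝ) (hc : 0 ≤ c)
      (h : Integrable F (ENNReal.ofReal c • (law p).map (fun ω => update ω k x))) :
      ∫ ω, F ω ∂(ENNReal.ofReal c • (law p).map (fun ω => update ω k x)) =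
        c * ∫ ω, F (update ω k x) ∂law p := by
    rw [integral_smul_measure, ENNReal.toReal_ofReal hc, smul_eq_mul]
    rcases hc.eq_or_lt with rfl | hc
    · simp
    · rw [integral_map (measurable_update_const k x).aemeasurable]
      exact ((integrable_smul_measure (by simpa using hc) (by simp)).1 h).aestronglyMeasurable
  rw [integral_add_measure hF'.1 hF'.2, hm _ _ (p k).2.1 hF'.1,
    hm _ _ (sub_nonneg.2 (p k).2.2) hF'.2]

/-! ### The discrete gradient -/

lemma measurable_D {F : PathSpace → ℝ} (hF : Measurable F) (k : ℕ) : Measurable (D p k F) :=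
  ((hF.comp (measurable_update_const k 1)).sub
    (hF.comp (measurable_update_const k (-1)))).const_mul _

lemma integrable_D (hp : ∀ k, 0 < p k ∧ p k < 1) {F : PathSpace → ℝ}
    (hF : Integrable F (law p)) (k : ℕ) : Integrable (D p k F) (law p) :=
  ((hF.comp_update hp k 1).sub (hF.comp_update hp k (-1))).const_mul _

lemma D_congr_ae (hp : ∀ k, 0 < p k ∧ p k < 1) {F G : PathSpace → ℝ} (h : F =ᵐ[law p] G)
    (k : ℕ) : D p k F =ᵐ[law p] D p k G := by
  filter_upwards [(quasiMeasurePreserving_update hp k 1).ae_eq_comp h,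
    (quasiMeasurePreserving_update hp k (-1)).ae_eq_comp h] with ω h1 h2
  simp only [comp_apply] at h1 h2
  simp only [D, h1, h2]

@[simp] lemma D_update (k : ℕ) (F : PathSpace → ℝ) (ω : PathSpace) (x : ℤˣ) :
    D p k F (update ω k x) = D p k F ω := by simp [D]

lemma D_eq_zero {k : ℕ} {F : PathSpace → ℝ} (h : ∀ ω x, F (update ω k x) = F ω) :
    D p k F = 0 := by ext ω; simp [D, h]

/-- The normalized coordinate `Y_k`, centred with unit variance. -/
def Y (p : ℕ → I) (k : ℕ) : PathSpace → ℝ := fun ω =>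
  if ω k = 1 then (1 - p k) / √(pq p k) else - p k / √(pq p k)

/-! ### Functionals of finitely many coordinates -/

lemma _root_.DependsOn.comp₂ {S : Set ℕ} {α β γ : Type*} {F : PathSpace → α} {G : PathSpace → β}
    (φ : α → β → γ) (hF : DependsOn F S) (hG : DependsOn G S) :
    DependsOn (fun ω => φ (F ω) (G ω)) S := fun ω ω' h => by
  simp only [hF h, hG h]

lemma _root_.DependsOn.comp₁ {S : Set ℕ} {α β : Type*} {F : PathSpace → α}
    (φ : α → β) (hF : DependsOn F S) : DependsOn (fun ω => φ (F ω)) S := fun ω ω' h => by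
  simp only [hF h]

lemma _root_.DependsOn.sum {S : Set ℕ} {ι : Type*} {s : Finset ι} {F : ι → PathSpace → ℝ}
    (hF : ∀ i ∈ s, DependsOn (F i) S) : DependsOn (fun ω => ∑ i ∈ s, F i ω) S :=
  fun _ _ h => Finset.sum_congr rfl fun i hi => hF i hi h

lemma _root_.DependsOn.D {S : Set ℕ} {F : PathSpace → ℝ} (hF : DependsOn F S) (k : ℕ) :
    DependsOn (D p k F) S := fun ω ω' h => by
  have (x : ℤˣ) : F (update ω k x) = F (update ω' k x) := hF fun i hi => by
    by_cases hik : i = k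
    · subst hik; simp
    · simp [hik, h i hi]
  simp only [Rademacher.D, this]

lemma dependsOn_Y {S : Set ℕ} {k : ℕ} (hk : k ∈ S) : DependsOn (Y p k) S :=
  fun ω ω' h => by simp only [Y, h k hk]

lemma _root_.DependsOn.measurable {N : Finset ℕ} {α : Type*} [Nonempty α] [MeasurableSpace α]
    {F : PathSpace → α} (hF : DependsOn F (N : Set ℕ)) : Measurable F := by
  obtain ⟨g, rfl⟩ := dependsOn_iff_exists_comp.1 hF
  have : Countable (∀ _ : (N : Set ℕ), ℤˣ) := by
    have : Finite (∀ _ : (N : Set ℕ), ℤˣ) := inferInstance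
    infer_instance
  exact (measurable_of_countable g).comp (by fun_prop)

lemma _root_.DependsOn.integrable {N : Finset ℕ} {F : PathSpace → ℝ}
    (hF : DependsOn F (N : Set ℕ)) : Integrable F (law p) := by
  have hm := hF.measurable
  obtain ⟨g, rfl⟩ := dependsOn_iff_exists_comp.1 hF
  obtain ⟨C, hC⟩ := (Set.finite_range fun x => ‖g x‖).bddAbove
  exact .of_bound hm.aestronglyMeasurable C (.of_forall fun ω => hC ⟨_, rfl⟩)

/-- Integration by parts. -/
lemma integral_mul_Y_mul (hp : ∀ k, 0 < p k ∧ p k < 1) {N : Finset ℕ} {G H : PathSpace → ℝ}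
    {k : ℕ} (hk : k ∈ N)
    (hG : DependsOn G (N : Set ℕ)) (hH : DependsOn H (N : Set ℕ))
    (hHk : ∀ ω x, H (update ω k x) = H ω) :
    ∫ ω, G ω * (Y p k ω * H ω) ∂law p = ∫ ω, D p k G ω * H ω ∂law p := by
  have hs : √(pq p k) ^ 2 = pq p k := Real.sq_sqrt (pq_pos hp k).le
  have hs0 : √(pq p k) ≠ 0 := (Real.sqrt_pos.2 (pq_pos hp k)).ne'
  have hi : DependsOn (fun ω => G ω * (Y p k ω * H ω)) (N : Set ℕ) :=
    hG.comp₂ (· * ·) ((dependsOn_Y hk).comp₂ (· * ·) hH)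
  -- Averaging out coordinate `k` leaves the weights p_k(1 - p_k)/√(p_k q_k) and its negative, that
  -- is ±√(p_k q_k), which are the coefficients of the gradient.
  rw [integral_law_eq hi.integrable k]
  have h (x : ℤˣ) : Integrable (fun ω => G (update ω k x) *
      (Y p k (update ω k x) * H (update ω k x))) (law p) := hi.integrable.comp_update hp k x
  rw [← integral_const_mul, ← integral_const_mul,
    ← integral_add ((h 1).const_mul _) ((h (-1)).const_mul _)]
  refine integral_congr_ae (.of_forall fun ω => ?_)
  have h11 : (-1 : ℤˣ) ≠ 1 := by decide
  simp only [Y, hHk, update_self, if_true, h11, if_false, D]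
  field_simp
  rw [hs, pq]
  ring

/-! ### Averaging over the coordinates outside a finite set -/

/-- A property of finitely many coordinates which holds almost surely holds everywhere. -/
lemma forall_of_ae (hp : ∀ k, 0 < p k ∧ p k < 1) {S : Finset ℕ} {Q : PathSpace → Prop}
    (h : ∀ᵐ ω ∂law p, Q ω) (hQ : ∀ ω ω', (∀ i ∈ S, ω i = ω' i) → Q ω → Q ω') (ω : PathSpace) :
    Q ω := by
  by_contra hω
  -- A failure at `ω` would propagate to the whole cylinder through `ω` over `S`, whose mass is a
  -- finite product of positive numbers.
  have h0 : law p (Set.pi S fun i => {ω i}) = 0 :=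
    measure_mono_null (fun ω' h' hQ' => hω (hQ ω' ω (fun i hi => h' i hi) hQ')) h
  rw [law, Measure.infinitePi_pi _ fun i _ => .of_discrete, Finset.prod_eq_zero_iff] at h0
  obtain ⟨i, -, hi⟩ := h0
  have h1 : unitInterval.toNNReal (p i) ≠ 0 := fun h => (hp i).1.ne' (by
    rw [← NNReal.coe_inj, unitInterval.coe_toNNReal] at h; exact Subtype.ext h)
  have h2 : unitInterval.toNNReal (σ (p i)) ≠ 0 := fun h => (hp i).2.ne (by
    rw [← NNReal.coe_inj, unitInterval.coe_toNNReal] at h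
    exact unitInterval.symm_eq_zero.1 (Subtype.ext h))
  rw [bernoulliMeasure_def] at hi
  simp only [Measure.coe_add, Pi.add_apply, add_eq_zero, Measure.smul_apply,
    Measure.dirac_apply, ENNReal.smul_def, smul_eq_mul, mul_eq_zero, ENNReal.coe_eq_zero, h1, h2,
    false_or] at hi
  rcases Int.units_eq_one_or (ω i) with h | h
  · simp [h] at hi
  · simp [h] at hi

/-- The average of `X` over the coordinates outside `S`. -/
def condE (p : ℕ → I) (S : Finset ℕ) (X : PathSpace → ℝ) : PathSpace → ℝ := fun ω =>
  ∫ ω', X (S.piecewise ω ω') ∂law p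

/-- Fubini gives integrability for almost every `ω`; the condition involves only the coordinates in
`S`, so `forall_of_ae` upgrades it to every `ω`. This is what allows `condE` identities to hold
pointwise. -/
lemma _root_.MeasureTheory.Integrable.comp_piecewise (hp : ∀ k, 0 < p k ∧ p k < 1)
    {X : PathSpace → ℝ} (hX : Integrable X (law p)) (S : Finset ℕ) (ω : PathSpace) :
    Integrable (fun ω' => X (S.piecewise ω ω')) (law p) := by
  have h := ((measurePreserving_piecewise (p := p) S).integrable_comp_of_integrable hX).prod_right_ae
  refine forall_of_ae hp (S := S) h (fun ω₁ ω₂ h12 hi => ?_) ω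
  have (ω' : PathSpace) : S.piecewise ω₂ ω' = S.piecewise ω₁ ω' :=
    Finset.piecewise_congr _ (fun i hi => (h12 i hi).symm) fun _ _ => rfl
  simpa only [this, comp_def] using hi

lemma dependsOn_condE (S : Finset ℕ) (X : PathSpace → ℝ) :
    DependsOn (condE p S X) (S : Set ℕ) := fun ω₁ ω₂ h => by
  have (ω' : PathSpace) : S.piecewise ω₁ ω' = S.piecewise ω₂ ω' :=
    Finset.piecewise_congr _ (fun i hi => h i hi) fun _ _ => rfl
  simp only [condE, this]

lemma dependsOn_condE_of_subset {S N : Finset ℕ} (h : S ⊆ N) (X : PathSpace → ℝ) :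
    DependsOn (condE p S X) (N : Set ℕ) :=
  (dependsOn_condE S X).mono (by simpa using h)

lemma condE_eq_self {S : Finset ℕ} {X : PathSpace → ℝ} (hX : DependsOn X (S : Set ℕ)) :
    condE p S X = X := by
  ext ω
  have (ω' : PathSpace) : X (S.piecewise ω ω') = X ω :=
    hX fun i hi => Finset.piecewise_eq_of_mem _ _ _ hi
  simp [condE, this]

lemma condE_empty (X : PathSpace → ℝ) (ω : PathSpace) : condE p ∅ X ω = ∫ ω', X ω' ∂law p := by
  simp [condE]

lemma piecewise_update_left {S : Finset ℕ} {k : ℕ} (hk : k ∈ S) (ω ω' : PathSpace) (x : ℤˣ) :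
    S.piecewise (update ω k x) ω' = update (S.piecewise ω ω') k x := by
  ext i
  by_cases hi : i = k
  · subst hi; simp [hk]
  · simp [Finset.piecewise, hi]

lemma piecewise_update_left_of_notMem {S : Finset ℕ} {k : ℕ} (hk : k ∉ S) (ω ω' : PathSpace)
    (x : ℤˣ) : S.piecewise (update ω k x) ω' = S.piecewise ω ω' :=
  Finset.piecewise_congr _ (fun i hi => update_of_ne (by rintro rfl; exact hk hi) _ _)
    fun _ _ => rfl

lemma piecewise_update_right {S : Finset ℕ} {k : ℕ} (hk : k ∉ S) (ω ω' : PathSpace) (x : ℤˣ) :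
    S.piecewise ω (update ω' k x) = update (S.piecewise ω ω') k x := by
  ext i
  by_cases hi : i = k
  · subst hi; simp [hk]
  · simp [Finset.piecewise, hi]

lemma D_condE_of_mem (hp : ∀ k, 0 < p k ∧ p k < 1) {X : PathSpace → ℝ}
    (hX : Integrable X (law p)) {S : Finset ℕ} {k : ℕ} (hk : k ∈ S) :
    D p k (condE p S X) = condE p S (D p k X) := by
  ext ω
  simp only [D, condE, piecewise_update_left hk]
  rw [integral_const_mul, integral_sub]
  · exact (hX.comp_update hp k 1).comp_piecewise hp S ω
  · exact (hX.comp_update hp k (-1)).comp_piecewise hp S ω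

lemma condE_update_of_notMem {X : PathSpace → ℝ} {S : Finset ℕ} {k : ℕ} (hk : k ∉ S)
    (ω : PathSpace) (x : ℤˣ) : condE p S X (update ω k x) = condE p S X ω := by
  simp only [condE, piecewise_update_left_of_notMem hk]

lemma D_condE_of_notMem {X : PathSpace → ℝ} {S : Finset ℕ} {k : ℕ} (hk : k ∉ S) :
    D p k (condE p S X) = 0 :=
  D_eq_zero (condE_update_of_notMem hk)

lemma condE_D_update (X : PathSpace → ℝ) (S : Finset ℕ) (k : ℕ) (ω : PathSpace) (x : ℤˣ) :
    condE p S (D p k X) (update ω k x) = condE p S (D p k X) ω := by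
  by_cases hk : k ∈ S
  · simp only [condE, piecewise_update_left hk, D_update]
  · exact condE_update_of_notMem hk ω x

/-- A function of a two-valued variable minus its mean is the normalized variable times the scaled
difference of its two values. This is applied to coordinate `k` after the coordinates outside
`insert k S` are averaged. -/
lemma condE_insert_sub (hp : ∀ k, 0 < p k ∧ p k < 1) {X : PathSpace → ℝ}
    (hX : Integrable X (law p)) {S : Finset ℕ} {k : ℕ} (hk : k ∉ S) (ω : PathSpace) :
    condE p (insert k S) X ω - condE p S X ω = Y p k ω * condE p S (D p k X) ω := by
  have hs0 : √(pq p k) ≠ 0 := (Real.sqrt_pos.2 (pq_pos hp k)).ne'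
  have h1 : condE p S X ω = p k * ∫ ω', X (update (S.piecewise ω ω') k 1) ∂law p +
      (1 - p k) * ∫ ω', X (update (S.piecewise ω ω') k (-1)) ∂law p := by
    rw [condE, integral_law_eq (hX.comp_piecewise hp S ω) k]
    simp only [piecewise_update_right hk]
  have h2 : condE p S (D p k X) ω = √(pq p k) * (∫ ω', X (update (S.piecewise ω ω') k 1) ∂law p -
      ∫ ω', X (update (S.piecewise ω ω') k (-1)) ∂law p) := by
    simp only [condE, D]
    rw [integral_const_mul, integral_sub]
    · exact (hX.comp_update hp k 1).comp_piecewise hp S ω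
    · exact (hX.comp_update hp k (-1)).comp_piecewise hp S ω
  rw [h1, h2]
  simp only [condE, Finset.piecewise_insert, Y]
  rcases Int.units_eq_one_or (ω k) with h | h
  · rw [h, if_pos rfl]; field_simp; ring
  · rw [h, if_neg (by decide)]; field_simp; ring

/-- The gradient in direction `k` ignores coordinate `k`, so averaging it over the complement of `S`
or of `S.erase k` is the same. The increment formula therefore needs no case distinction on `k ∈ S`.
-/
lemma condE_insert_sub_erase (hp : ∀ k, 0 < p k ∧ p k < 1) {X : PathSpace → ℝ}
    (hX : Integrable X (law p)) (S : Finset ℕ) (k : ℕ) (ω : PathSpace) :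
    condE p (insert k S) X ω - condE p (S.erase k) X ω = Y p k ω * condE p S (D p k X) ω := by
  by_cases hk : k ∈ S
  · have h := condE_insert_sub hp hX (S.notMem_erase k) ω
    rw [Finset.insert_erase hk] at h
    rw [Finset.insert_eq_of_mem hk, h]
    congr 1
    conv_rhs => rw [← Finset.insert_erase hk]
    simp only [condE, Finset.piecewise_insert, D_update]
  · rw [Finset.erase_eq_of_notMem hk, condE_insert_sub hp hX hk]

lemma measurable_condE {X : PathSpace → ℝ} {S : Finset ℕ} : Measurable (condE p S X) :=
  (dependsOn_condE S X).measurable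

lemma enorm_integral_rpow_le {Ω : Type*} [MeasurableSpace Ω] {μ : Measure Ω}
    [IsProbabilityMeasure μ] {X : Ω → ℝ} (hX : AEStronglyMeasurable X μ) {t : ℝ} (ht : 1 ≤ t) :
    ‖∫ ω, X ω ∂μ‖ₑ ^ t ≤ ∫⁻ ω, ‖X ω‖ₑ ^ t ∂μ := by
  have h0 : 0 < t := zero_lt_one.trans_le ht
  have h1 := eLpNorm'_le_eLpNorm'_of_exponent_le zero_lt_one ht μ hX
  simp only [eLpNorm', ENNReal.rpow_one, div_one] at h1
  calc ‖∫ ω, X ω ∂μ‖ₑ ^ t ≤ ((∫⁻ ω, ‖X ω‖ₑ ^ t ∂μ) ^ (1 / t)) ^ t :=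
        ENNReal.rpow_le_rpow ((enorm_integral_le_lintegral_enorm _).trans h1) h0.le
    _ = _ := by rw [← ENNReal.rpow_mul, one_div_mul_cancel h0.ne', ENNReal.rpow_one]

lemma ofReal_abs_rpow (x : ℝ) {t : ℝ} (ht : 0 ≤ t) : ENNReal.ofReal (|x| ^ t) = ‖x‖ₑ ^ t := by
  rw [← ENNReal.ofReal_rpow_of_nonneg (abs_nonneg x) ht, Real.enorm_eq_ofReal_abs]

lemma lintegral_piecewise (S : Finset ℕ) {g : PathSpace → ℝ≥0∞} (hg : Measurable g) :
    ∫⁻ ω, ∫⁻ ω', g (S.piecewise ω ω') ∂law p ∂law p = ∫⁻ ω, g ω ∂law p := by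
  rw [← (measurePreserving_piecewise (p := p) S).lintegral_comp hg,
    lintegral_prod (fun z => g _) (hg.comp (measurable_piecewise S)).aemeasurable]

lemma measurable_piecewise_right (S : Finset ℕ) (ω : PathSpace) :
    Measurable fun ω' : PathSpace => S.piecewise ω ω' :=
  (measurable_piecewise S).comp measurable_prodMk_left

/-- Averaging contracts moments. -/
lemma expect_condE_rpow_le {X : PathSpace → ℝ} (hX : Measurable X) (S : Finset ℕ) {t : ℝ}
    (ht : 1 ≤ t) : expect p (fun ω => |condE p S X ω| ^ t) ≤ expect p (fun ω => |X ω| ^ t) := by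
  have h0 : 0 ≤ t := zero_le_one.trans ht
  simp only [expect, ofReal_abs_rpow _ h0]
  rw [← lintegral_piecewise S (hX.enorm.pow_const t)]
  exact lintegral_mono fun ω => enorm_integral_rpow_le
    (hX.comp (measurable_piecewise_right S ω)).aestronglyMeasurable ht

/-! ### Random subsets with uniformly distributed cardinality -/

/-- The probability that a random subset of an `n`-element set, which has uniformly distributed
cardinality and is uniform given its cardinality, is a given set of cardinality `s`. -/
def cardWeight (n s : ℕ) : ℝ := ((n + 1) * n.choose s)⁻¹

/-- The probability that the random subset of `N` equals `S`. -/
def weight (N S : Finset ℕ) : ℝ := cardWeight N.card S.card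

lemma weight_nonneg (N S : Finset ℕ) : 0 ≤ weight N S := by unfold weight cardWeight; positivity

lemma sum_weight (N : Finset ℕ) : ∑ S ∈ N.powerset, weight N S = 1 := by
  simp only [weight]
  rw [Finset.sum_powerset_apply_card (cardWeight N.card)]
  have : ∀ m ∈ Finset.range (N.card + 1), N.card.choose m • cardWeight N.card m =
      ((N.card : ℝ) + 1)⁻¹ := fun m hm => by
    have : (N.card.choose m : ℝ) ≠ 0 := by
      have := Nat.choose_pos (Finset.mem_range_succ_iff.1 hm)
      positivity
    rw [nsmul_eq_mul, cardWeight]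
    field_simp
  rw [Finset.sum_congr rfl this]
  simp
  field_simp

lemma weight_sdiff {N S : Finset ℕ} (h : S ⊆ N) : weight N (N \ S) = weight N S := by
  rw [weight, weight, cardWeight, cardWeight, Finset.card_sdiff_of_subset h,
    Nat.choose_symm (Finset.card_le_card h)]

/-- Complementation in `N` preserves the weights and exchanges the events that `l` is in or out of
the random set, so each has probability 1/2. -/
lemma sum_weight_ite {N : Finset ℕ} {l : ℕ} (hl : l ∈ N) :
    ∑ S ∈ N.powerset, (if l ∈ S then weight N S else 0) = 1 / 2 := by
  have h1 : ∑ S ∈ N.powerset, (if l ∈ S then weight N S else 0) =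
      ∑ S ∈ N.powerset, (if l ∈ S then 0 else weight N S) := by
    refine Finset.sum_nbij' (fun S => N \ S) (fun S => N \ S) (by simp) (by simp) ?_ ?_ ?_
    · intro S hS
      simp [Finset.mem_powerset.1 hS]
    · intro S hS
      simp [Finset.mem_powerset.1 hS]
    · intro S hS
      simp only [Finset.mem_sdiff, hl, true_and, weight_sdiff (Finset.mem_powerset.1 hS)]
      split_ifs <;> simp_all
  have h2 := sum_weight N
  have h3 : ∀ S ∈ N.powerset, weight N S = (if l ∈ S then weight N S else 0) +
      (if l ∈ S then 0 else weight N S) := fun S _ => by split_ifs <;> simp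
  rw [Finset.sum_congr rfl h3, Finset.sum_add_distrib, ← h1] at h2
  linarith

/-- From (s+1)·C(n,s+1) = (n-s)·C(n,s), the sum of the reciprocals of two neighbouring binomials is
(n+1)/((n-s)·C(n,s)); the factor n+1 cancels the one in the weight. -/
lemma sub_mul_cardWeight_add {n s : ℕ} (h : s < n) :
    ((n : ℝ) - s) * (cardWeight n s + cardWeight n (s + 1)) = (n.choose s : ℝ)⁻¹ ∧
    ((s : ℝ) + 1) * (cardWeight n s + cardWeight n (s + 1)) = (n.choose (s + 1) : ℝ)⁻¹ := by
  have h1 : (n.choose (s + 1) : ℝ) * (s + 1) = n.choose s * (n - s) := by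
    rw [← Nat.cast_sub h.le]
    exact_mod_cast Nat.choose_succ_right_eq n s
  have h2 : (n.choose s : ℝ) ≠ 0 := by exact_mod_cast (Nat.choose_pos h.le).ne'
  have h3 : (n.choose (s + 1) : ℝ) ≠ 0 := by exact_mod_cast (Nat.choose_pos h).ne'
  have h4 : (n : ℝ) - s ≠ 0 := by
    have : (s : ℝ) < n := by exact_mod_cast h
    linarith
  have h5 : (n : ℝ) + 1 ≠ 0 := by positivity
  unfold cardWeight
  constructor
  · field_simp
    linear_combination -h1
  · field_simp
    linear_combination h1

/-- Collect the coefficient of `a T`: it is produced |T| times by insertion and n - |T| times, with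
a minus sign, by erasure. By `sub_mul_cardWeight_add` both contributions equal the reciprocal
binomial and cancel, except that the first vanishes at `∅` and the second at `N`. -/
lemma sum_weight_mul_sub {N : Finset ℕ} (a : Finset ℕ → ℝ) :
    ∑ k ∈ N, ∑ S ∈ N.powerset, weight N S * (a (insert k S) - a (S.erase k)) = a N - a ∅ := by
  have h1 : ∀ k ∈ N, ∑ S ∈ N.powerset, weight N S * (a (insert k S) - a (S.erase k)) =
      ∑ T ∈ N.powerset, a T * (if k ∈ T
        then cardWeight N.card (T.card - 1) + cardWeight N.card T.card
        else -(cardWeight N.card T.card + cardWeight N.card (T.card + 1))) := fun k hk => by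
    simp only [weight]
    generalize N.card = n
    obtain ⟨M, hM, rfl⟩ : ∃ M, k ∉ M ∧ insert k M = N :=
      ⟨N.erase k, N.notMem_erase k, Finset.insert_erase hk⟩
    -- Pairing each `S` not containing `k` with `insert k S` lets one compare coefficients termwise:
    -- both members give the same increment of `a`.
    rw [Finset.sum_powerset_insert hM, Finset.sum_powerset_insert hM, ← Finset.sum_add_distrib,
      ← Finset.sum_add_distrib]
    refine Finset.sum_congr rfl fun S hS => ?_
    have hkS : k ∉ S := fun h => hM (Finset.mem_powerset.1 hS h)
    simp only [Finset.erase_eq_of_notMem hkS, Finset.insert_idem, Finset.erase_insert hkS,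
      Finset.card_insert_of_notMem hkS, hkS, if_false, Finset.mem_insert_self, if_true,
      Nat.add_sub_cancel]
    ring
  rw [Finset.sum_congr rfl h1, Finset.sum_comm]
  have h2 : ∀ T ∈ N.powerset, ∑ k ∈ N, a T * (if k ∈ T
        then cardWeight N.card (T.card - 1) + cardWeight N.card T.card
        else -(cardWeight N.card T.card + cardWeight N.card (T.card + 1))) =
      (if T = N then a T else 0) - (if T = ∅ then a T else 0) := fun T hT => by
    have hTN := Finset.mem_powerset.1 hT
    have hc := Finset.card_le_card hTN
    rw [← Finset.mul_sum, Finset.sum_ite, Finset.sum_const, Finset.sum_const,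
      Finset.filter_mem_eq_inter, Finset.inter_eq_right.2 hTN, Finset.filter_notMem_eq_sdiff,
      Finset.card_sdiff_of_subset hTN, nsmul_eq_mul, nsmul_eq_mul, Nat.cast_sub hc]
    have hA : (T.card : ℝ) * (cardWeight N.card (T.card - 1) + cardWeight N.card T.card) =
        if T = ∅ then 0 else (N.card.choose T.card : ℝ)⁻¹ := by
      split_ifs with h
      · simp [h]
      · obtain ⟨s, hs⟩ := Nat.exists_eq_succ_of_ne_zero (Finset.card_ne_zero.2
          (Finset.nonempty_iff_ne_empty.2 h))
        rw [hs] at hc ⊢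
        have := (sub_mul_cardWeight_add (n := N.card) (s := s) (by omega)).2
        simpa using this
    have hB : ((N.card : ℝ) - T.card) * (cardWeight N.card T.card + cardWeight N.card (T.card + 1))
        = if T = N then 0 else (N.card.choose T.card : ℝ)⁻¹ := by
      split_ifs with h
      · simp [h]
      · exact (sub_mul_cardWeight_add (Finset.card_lt_card (hTN.ssubset_of_ne h))).1
    rw [mul_neg, ← sub_eq_add_neg, hA, hB]
    by_cases hE : T = ∅ <;> by_cases hN : T = N
    · simp [hE, hN.symm]
    · simp [hE, hE ▸ hN]
    · simp [hN, hN ▸ hE]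
    · simp [hE, hN]
  rw [Finset.sum_congr rfl h2, Finset.sum_sub_distrib]
  simp

/-! ### Covariance identity -/

/-- The integrand in the covariance representation: for functionals of the coordinates in `N`,
this is `-D_k L⁻¹ F`. -/
def dInv (p : ℕ → I) (N : Finset ℕ) (k : ℕ) (F : PathSpace → ℝ) : PathSpace → ℝ := fun ω =>
  ∑ S ∈ N.powerset, weight N S * condE p S (D p k F) ω

lemma dependsOn_dInv (N : Finset ℕ) (k : ℕ) (F : PathSpace → ℝ) :
    DependsOn (dInv p N k F) (N : Set ℕ) :=
  .sum fun _ hS => (dependsOn_condE_of_subset (Finset.mem_powerset.1 hS) _).comp₁ _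

lemma dInv_update (N : Finset ℕ) (k : ℕ) (F : PathSpace → ℝ) (ω : PathSpace) (x : ℤˣ) :
    dInv p N k F (update ω k x) = dInv p N k F ω := by
  simp only [dInv, condE_D_update]

lemma D_dInv (hp : ∀ k, 0 < p k ∧ p k < 1) {F : PathSpace → ℝ} (hF : Integrable F (law p))
    (N : Finset ℕ) (k l : ℕ) (ω : PathSpace) :
    D p l (dInv p N k F) ω =
      ∑ S ∈ N.powerset, (if l ∈ S then weight N S else 0) * condE p S (D p l (D p k F)) ω := by
  have h : D p l (dInv p N k F) ω =
      ∑ S ∈ N.powerset, weight N S * D p l (condE p S (D p k F)) ω := by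
    simp only [D, dInv]
    rw [← Finset.sum_sub_distrib, Finset.mul_sum]
    exact Finset.sum_congr rfl fun S _ => by ring
  rw [h]
  refine Finset.sum_congr rfl fun S _ => ?_
  split_ifs with hl
  · rw [D_condE_of_mem hp (integrable_D hp hF k) hl]
  · rw [D_condE_of_notMem hl]; simp

/-- Telescope the set function S ↦ E[G · `condE p S F`] from `∅` to `N`. Every increment carries a
factor `Y p k`, which integration by parts turns into a gradient of `G`. -/
lemma covariance_eq (hp : ∀ k, 0 < p k ∧ p k < 1) {N : Finset ℕ} {F G : PathSpace → ℝ}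
    (hF : Integrable F (law p)) (hG : DependsOn G (N : Set ℕ)) :
    ∫ ω, G ω * condE p N F ω ∂law p - (∫ ω, G ω ∂law p) * ∫ ω, F ω ∂law p =
      ∑ k ∈ N, ∫ ω, D p k G ω * dInv p N k F ω ∂law p := by
  have h := sum_weight_mul_sub (N := N) fun S => ∫ ω, G ω * condE p S F ω ∂law p
  simp only [condE_empty, integral_mul_const] at h
  rw [← h]
  refine Finset.sum_congr rfl fun k hk => ?_
  have hi (S : Finset ℕ) (hS : S ⊆ N) (X : PathSpace → ℝ) {G : PathSpace → ℝ}
      (hG : DependsOn G (N : Set ℕ)) :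
      Integrable (fun ω => G ω * condE p S X ω) (law p) :=
    (hG.comp₂ (· * ·) (dependsOn_condE_of_subset hS X)).integrable
  simp only [dInv, Finset.mul_sum]
  rw [integral_finsetSum _ fun S hS => 
    ((hG.D k).comp₂ (fun a b => a * (weight N S * b))
      (dependsOn_condE_of_subset (Finset.mem_powerset.1 hS) _)).integrable]
  refine Finset.sum_congr rfl fun S hS => ?_
  have hS := Finset.mem_powerset.1 hS
  rw [← integral_sub (hi _ (Finset.insert_subset hk hS) F hG)
    (hi _ ((S.erase_subset k).trans hS) F hG)]
  simp only [← mul_sub, condE_insert_sub_erase hp hF, mul_left_comm _ (weight N S)]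
  rw [integral_mul_Y_mul hp hk hG (dependsOn_condE_of_subset hS _) (condE_D_update F S k),
    integral_const_mul]

lemma ofReal_integral_eq_expect {N : Finset ℕ} {X : PathSpace → ℝ}
    (hX : DependsOn X (N : Set ℕ)) (h0 : ∀ ω, 0 ≤ X ω) :
    ENNReal.ofReal (∫ ω, X ω ∂law p) = expect p X :=
  ofReal_integral_eq_lintegral_ofReal hX.integrable (.of_forall h0)

lemma integral_condE_sq_le {N S : Finset ℕ} (hS : S ⊆ N) {X : PathSpace → ℝ}
    (hX : DependsOn X (N : Set ℕ)) :
    ∫ ω, condE p S X ω ^ 2 ∂law p ≤ ∫ ω, X ω ^ 2 ∂law p := by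
  have h := expect_condE_rpow_le (p := p) hX.measurable S one_le_two
  simp only [Real.rpow_two, sq_abs] at h
  rw [← ofReal_integral_eq_expect ((dependsOn_condE_of_subset hS X).comp₁ (· ^ 2))
    fun ω => sq_nonneg _, ← ofReal_integral_eq_expect (hX.comp₁ (· ^ 2)) fun ω => sq_nonneg _,
    ENNReal.ofReal_le_ofReal_iff (integral_nonneg fun ω => sq_nonneg _)] at h
  exact h

/-- The Poincaré inequality. -/
lemma variance_le (hp : ∀ k, 0 < p k ∧ p k < 1) {N : Finset ℕ} {Z : PathSpace → ℝ}
    (hZ : DependsOn Z (N : Set ℕ)) :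
    ∫ ω, Z ω ^ 2 ∂law p - (∫ ω, Z ω ∂law p) ^ 2 ≤ ∑ l ∈ N, ∫ ω, D p l Z ω ^ 2 ∂law p := by
  have h := covariance_eq hp hZ.integrable hZ
  rw [condE_eq_self hZ] at h
  simp only [← sq] at h
  rw [h]
  refine Finset.sum_le_sum fun k _ => ?_
  have hD := hZ.D (p := p) k
  have hi {X : PathSpace → ℝ} (hX : DependsOn X (N : Set ℕ)) (c : ℝ) :
      Integrable (fun ω => c * X ω ^ 2) (law p) := (hX.comp₁ fun x => c * x ^ 2).integrable
  -- `dInv` is a convex combination of averages of the gradient, so Jensen's inequality applies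
  -- twice: over the random set and over the averaged coordinates.
  have hA : ∫ ω, dInv p N k Z ω ^ 2 ∂law p ≤ ∫ ω, D p k Z ω ^ 2 ∂law p :=
    calc ∫ ω, dInv p N k Z ω ^ 2 ∂law p
        ≤ ∫ ω, ∑ S ∈ N.powerset, weight N S * condE p S (D p k Z) ω ^ 2 ∂law p :=
          integral_mono ((dependsOn_dInv N k Z).comp₁ (· ^ 2)).integrable
            (DependsOn.sum fun S hS => (dependsOn_condE_of_subset
              (Finset.mem_powerset.1 hS) _).comp₁ fun x => weight N S * x ^ 2).integrable
            fun ω => Real.pow_arith_mean_le_arith_mean_pow_of_even _ _ _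
              (fun S _ => weight_nonneg N S) (sum_weight N) even_two
      _ = ∑ S ∈ N.powerset, weight N S * ∫ ω, condE p S (D p k Z) ω ^ 2 ∂law p := by
          rw [integral_finsetSum _ fun S hS =>
            hi (dependsOn_condE_of_subset (Finset.mem_powerset.1 hS) _) _]
          simp only [integral_const_mul]
      _ ≤ ∑ S ∈ N.powerset, weight N S * ∫ ω, D p k Z ω ^ 2 ∂law p :=
          Finset.sum_le_sum fun S hS => mul_le_mul_of_nonneg_left
            (integral_condE_sq_le (Finset.mem_powerset.1 hS) hD) (weight_nonneg N S)
      _ = _ := by rw [← Finset.sum_mul, sum_weight, one_mul]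
  have h2 : ∫ ω, D p k Z ω * dInv p N k Z ω ∂law p ≤
      ∫ ω, (1 / 2 * D p k Z ω ^ 2 + 1 / 2 * dInv p N k Z ω ^ 2) ∂law p :=
    integral_mono (hD.comp₂ (· * ·) (dependsOn_dInv N k Z)).integrable
      ((hi hD _).add (hi (dependsOn_dInv N k Z) _))
      fun ω => by nlinarith [sq_nonneg (D p k Z ω - dInv p N k Z ω)]
  rw [integral_add (hi hD _) (hi (dependsOn_dInv N k Z) _), integral_const_mul,
    integral_const_mul] at h2
  linarith

end Rademacher

/-! ### The standard normal distribution -/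

namespace StdNormal

open Set Filter Topology Interval

lemma antitoneOn_of_hasDerivAt_nonpos {D : Set ℝ} (hD : Convex ℝ D) {f f' : ℝ → ℝ}
    (hf : ∀ x ∈ D, HasDerivAt f (f' x) x) (h : ∀ x ∈ D, f' x ≤ 0) : AntitoneOn f D :=
  antitoneOn_of_deriv_nonpos hD (fun x hx => (hf x hx).continuousAt.continuousWithinAt)
    (fun x hx => (hf x (interior_subset hx)).differentiableAt.differentiableWithinAt)
    fun x hx => (hf x (interior_subset hx)).deriv ▸ h x (interior_subset hx)

/-- The standard normal density. -/
def φ : ℝ → ℝ := gaussianPDFReal 0 1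

/-- The standard normal distribution function. -/
def Φ : ℝ → ℝ := cdf (gaussianReal 0 1)

lemma φ_eq (x : ℝ) : φ x = (√(2 * Real.pi))⁻¹ * Real.exp (-x ^ 2 / 2) := by
  simp [φ, gaussianPDFReal]

lemma φ_pos (x : ℝ) : 0 < φ x := gaussianPDFReal_pos 0 1 x one_ne_zero

lemma φ_neg (x : ℝ) : φ (-x) = φ x := by simp [φ_eq]

lemma hasDerivAt_φ (x : ℝ) : HasDerivAt φ (-x * φ x) x := by
  have h1 : HasDerivAt (fun x : ℝ => -x ^ 2 / 2) (-x) x := by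
    have := ((hasDerivAt_pow 2 x).neg.div_const 2)
    refine HasDerivAt.congr_deriv (this) ?_
    push_cast; ring
  have := (h1.exp.const_mul (√(2 * Real.pi))⁻¹)
  rw [show φ = fun x => (√(2 * Real.pi))⁻¹ * Real.exp (-x ^ 2 / 2) from funext φ_eq]
  refine HasDerivAt.congr_deriv (this) ?_
  ring

lemma continuous_φ : Continuous φ :=
  continuous_iff_continuousAt.2 fun x => (hasDerivAt_φ x).continuousAt

lemma Φ_eq_integral (x : ℝ) : Φ x = ∫ t in Iic x, φ t := by
  rw [Φ, cdf_eq_real, measureReal_def, gaussianReal_apply_eq_integral 0 one_ne_zero,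
    ENNReal.toReal_ofReal]
  · rfl
  · exact integral_nonneg fun t => gaussianPDFReal_nonneg 0 1 t

lemma hasDerivAt_Φ (x : ℝ) : HasDerivAt Φ (φ x) x := by
  have hi : Integrable φ := integrable_gaussianPDFReal 0 1
  have h : Φ = fun y => Φ 0 + ∫ t in (0 : ℝ)..y, φ t := by
    ext y
    rw [← intervalIntegral.integral_Iic_sub_Iic hi.integrableOn hi.integrableOn, Φ_eq_integral,
      Φ_eq_integral]
    ring
  rw [h]
  exact (intervalIntegral.integral_hasDerivAt_right (hi.intervalIntegrable)
    hi.aestronglyMeasurable.stronglyMeasurableAtFilter continuous_φ.continuousAt).const_add _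

lemma continuous_Φ : Continuous Φ :=
  continuous_iff_continuousAt.2 fun x => (hasDerivAt_Φ x).continuousAt

lemma Φ_nonneg (x : ℝ) : 0 ≤ Φ x := cdf_nonneg _ x

lemma Φ_le_one (x : ℝ) : Φ x ≤ 1 := cdf_le_one _ x

lemma Φ_mono : Monotone Φ := monotone_cdf _

lemma tendsto_Φ_atTop : Tendsto Φ atTop (𝓝 1) := tendsto_cdf_atTop _

lemma Φ_neg (x : ℝ) : Φ (-x) = 1 - Φ x := by
  have h := nullSingletonClass_gaussianReal (μ := 0) (v := 1) one_ne_zero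
  have h1 : (gaussianReal 0 1).real (Iic (-x)) = (gaussianReal 0 1).real (Ici x) := by
    conv_lhs => rw [← neg_zero, ← gaussianReal_map_neg]
    rw [map_measureReal_apply measurable_neg measurableSet_Iic]
    congr 1
    ext y
    simp
  rw [Φ, cdf_eq_real, h1, cdf_eq_real, ← probReal_compl_eq_one_sub measurableSet_Iic, compl_Iic,
    measureReal_congr Ioi_ae_eq_Ici]

lemma Φ_zero : Φ 0 = 1 / 2 := by
  have := Φ_neg 0
  rw [neg_zero] at this
  linarith

lemma tendsto_φ_atTop : Tendsto φ atTop (𝓝 0) := by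
  rw [show φ = fun x => (√(2 * Real.pi))⁻¹ * Real.exp (-x ^ 2 / 2) from funext φ_eq,
    ← mul_zero (√(2 * Real.pi))⁻¹]
  refine (Real.tendsto_exp_atBot.comp ?_).const_mul _
  have : Tendsto (fun x : ℝ => x ^ 2 / 2) atTop atTop :=
    (tendsto_pow_atTop two_ne_zero).atTop_div_const two_pos
  exact (tendsto_neg_atTop_atBot.comp this).congr fun x => by simp [neg_div]

/-- The Mills ratio inequality. -/
lemma mul_one_sub_Φ_le (y : ℝ) : y * (1 - Φ y) ≤ φ y := by
  rcases le_or_gt y 0 with hy | hy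
  · exact (mul_nonpos_of_nonpos_of_nonneg hy (sub_nonneg.2 (Φ_le_one y))).trans (φ_pos y).le
  -- On the positive half-line the gap φ(x)/x - (1 - Φ(x)) is decreasing with limit 0, hence
  -- nonnegative.
  have hd (x : ℝ) (hx : x ∈ Ioi (0 : ℝ)) :
      HasDerivAt (fun x => φ x / x - (1 - Φ x)) (-(φ x / x ^ 2)) x := by
    have h0 : x ≠ 0 := (mem_Ioi.1 hx).ne'
    refine HasDerivAt.congr_deriv (((hasDerivAt_φ x).div (hasDerivAt_id x) h0).sub ((hasDerivAt_Φ x).const_sub 1)) ?_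
    simp only [id]
    field_simp
    ring
  have ha := antitoneOn_of_hasDerivAt_nonpos (convex_Ioi 0) hd fun x _ =>
    neg_nonpos.2 (div_nonneg (φ_pos x).le (sq_nonneg x))
  have ht : Tendsto (fun x => φ x / x - (1 - Φ x)) atTop (𝓝 0) := by
    have := (tendsto_φ_atTop.mul tendsto_inv_atTop_zero).sub (tendsto_Φ_atTop.const_sub 1)
    simpa [div_eq_mul_inv] using this
  have h0 : 0 ≤ φ y / y - (1 - Φ y) := le_of_tendsto' (ht.comp
    (tendsto_atTop_add_const_left atTop y tendsto_natCast_atTop_atTop))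
    fun n : ℕ => ha hy (mem_Ioi.2 (by positivity)) (by simp)
  rw [sub_nonneg, le_div_iff₀ hy] at h0
  linarith

/-- The difference `h` of the two sides has derivative φ·g with `g` concave on [0, ∞) and g(0) = 0,
so `g` changes sign at most once, from plus to minus. Thus `h` first increases from 0 and then
decreases to its limit 0, and cannot become negative. -/
lemma four_mul_Φ_mul_le_of_pos {y : ℝ} (hy : 0 < y) :
    4 * (Φ y * (1 - Φ y)) ≤ √(2 * Real.pi) * φ y := by
  set c := √(2 * Real.pi)
  set g : ℝ → ℝ := fun y => 4 * (2 * Φ y - 1) - c * y with hg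
  set h : ℝ → ℝ := fun y => c * φ y - 4 * (Φ y * (1 - Φ y)) with hh
  have hc : 0 < c := Real.sqrt_pos.2 (by positivity)
  have hdh (x : ℝ) : HasDerivAt h (φ x * g x) x := by
    have := ((hasDerivAt_φ x).const_mul c).sub
      (((hasDerivAt_Φ x).mul ((hasDerivAt_Φ x).const_sub 1)).const_mul 4)
    refine HasDerivAt.congr_deriv (this) ?_
    simp only [hg]
    ring
  have hdg (x : ℝ) : HasDerivAt g (8 * φ x - c) x := by
    have := ((((hasDerivAt_Φ x).const_mul 2).sub_const 1).const_mul 4).sub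
      ((hasDerivAt_id x).const_mul c)
    refine HasDerivAt.congr_deriv (this) ?_
    ring
  have hφ : AntitoneOn φ (Ici 0) := antitoneOn_of_hasDerivAt_nonpos (convex_Ici 0)
    (fun x _ => hasDerivAt_φ x) fun x hx => by
      have := mul_nonneg (mem_Ici.1 hx) (φ_pos x).le
      linarith
  have hconc : ConcaveOn ℝ (Ici 0) g := by
    refine AntitoneOn.concaveOn_of_deriv (convex_Ici 0)
      (fun x _ => (hdg x).continuousAt.continuousWithinAt)
      (fun x _ => (hdg x).differentiableAt.differentiableWithinAt) ?_
    intro a ha b hb hab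
    rw [(hdg a).deriv, (hdg b).deriv]
    have := hφ (interior_subset ha) (interior_subset hb) hab
    linarith
  have hg0 : g 0 = 0 := by simp [hg, Φ_zero]
  have hh0 : h 0 = 0 := by
    simp only [hh, Φ_zero, φ_eq]
    have : c * c⁻¹ = 1 := mul_inv_cancel₀ hc.ne'
    simp [c] at this ⊢
    norm_num
    linarith
  -- Concavity along the segment from 0 to `b`: positivity of `g` propagates to the left and
  -- negativity to the right.
  have hseg {a b : ℝ} (ha : 0 ≤ a) (hab : a ≤ b) (hb : 0 < b) : a / b * g b ≤ g a := by
    have h1 : 0 ≤ a / b := by positivity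
    have h2 : 0 ≤ 1 - a / b := by
      rw [sub_nonneg, div_le_one hb]; exact hab
    have := hconc.2 (mem_Ici.2 le_rfl) (mem_Ici.2 hb.le) h2 h1 (by ring)
    simp only [smul_eq_mul, hg0, mul_zero, zero_add] at this
    rwa [div_mul_cancel₀ _ hb.ne'] at this
  suffices 0 ≤ h y by simp only [hh] at this; linarith
  rcases le_or_gt 0 (g y) with hgy | hgy
  · have hm : AntitoneOn (fun x => -h x) (Icc 0 y) :=
      antitoneOn_of_hasDerivAt_nonpos (convex_Icc 0 y) (fun x _ => (hdh x).neg) fun x hx => by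
        rw [neg_nonpos]
        exact mul_nonneg (φ_pos x).le
          ((mul_nonneg (div_nonneg hx.1 hy.le) hgy).trans (hseg hx.1 hx.2 hy))
    have := hm (left_mem_Icc.2 hy.le) (right_mem_Icc.2 hy.le) hy.le
    simp only [hh0] at this
    linarith
  · have hm : AntitoneOn h (Ici y) :=
      antitoneOn_of_hasDerivAt_nonpos (convex_Ici y) (fun x _ => hdh x) fun x hx => by
        have hx0 : 0 < x := hy.trans_le hx
        refine mul_nonpos_of_nonneg_of_nonpos (φ_pos x).le ?_
        by_contra! hgx
        exact hgy.not_ge ((mul_nonneg (by positivity) hgx.le).trans (hseg hy.le hx hx0))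
    have ht : Tendsto h atTop (𝓝 0) := by
      have := (tendsto_φ_atTop.const_mul c).sub
        ((tendsto_Φ_atTop.mul (tendsto_Φ_atTop.const_sub 1)).const_mul 4)
      simpa using this
    refine le_of_tendsto' (ht.comp (tendsto_atTop_add_const_left atTop y
      tendsto_natCast_atTop_atTop)) fun n : ℕ => ?_
    simpa using hm (mem_Ici.2 le_rfl)
      (mem_Ici.2 (le_add_of_nonneg_right n.cast_nonneg)) (le_add_of_nonneg_right n.cast_nonneg)

lemma Φ_mul_one_sub_le (y : ℝ) : Φ y * (1 - Φ y) ≤ √(2 * Real.pi) / 4 * φ y := by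
  rcases lt_trichotomy y 0 with hy | rfl | hy
  · have := four_mul_Φ_mul_le_of_pos (neg_pos.2 hy)
    rw [Φ_neg, φ_neg] at this
    linarith
  · rw [Φ_zero, φ_eq]
    have : √(2 * Real.pi) * (√(2 * Real.pi))⁻¹ = 1 := mul_inv_cancel₀ (by positivity)
    norm_num at this ⊢
    linarith
  · linarith [four_mul_Φ_mul_le_of_pos hy]

/-! ### The Stein equation for half-lines -/

/-- The ratio `Φ / φ`, which solves `R' = 1 + y R`. -/
def R (y : ℝ) : ℝ := Φ y / φ y

lemma R_nonneg (y : ℝ) : 0 ≤ R y := div_nonneg (Φ_nonneg y) (φ_pos y).le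

lemma hasDerivAt_R (y : ℝ) : HasDerivAt R (1 + y * R y) y := by
  have h0 := (φ_pos y).ne'
  refine HasDerivAt.congr_deriv ((hasDerivAt_Φ y).div (hasDerivAt_φ y) h0) ?_
  simp only [R]
  field_simp
  ring

lemma continuous_R : Continuous R :=
  continuous_iff_continuousAt.2 fun x => (hasDerivAt_R x).continuousAt

/-- This is the Mills ratio inequality at `-y`, divided by the density. -/
lemma one_add_mul_R_nonneg (y : ℝ) : 0 ≤ 1 + y * R y := by
  have := mul_one_sub_Φ_le (-y)
  rw [Φ_neg, φ_neg] at this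
  have h : -(y * R y) ≤ 1 := by
    rw [R, ← mul_div_assoc, ← neg_div, div_le_one (φ_pos y)]
    linarith
  linarith

lemma one_sub_Φ_mul_R_le {x y : ℝ} (h : y ≤ x) : (1 - Φ x) * R y ≤ √(2 * Real.pi) / 4 :=
  calc (1 - Φ x) * R y ≤ (1 - Φ y) * R y :=
        mul_le_mul_of_nonneg_right (by linarith [Φ_mono h]) (R_nonneg y)
    _ ≤ _ := by
      rw [R, ← mul_div_assoc, div_le_iff₀ (φ_pos y), mul_comm]
      exact Φ_mul_one_sub_le y

lemma one_sub_Φ_mul_one_add_le {x y : ℝ} (h : y ≤ x) : (1 - Φ x) * (1 + y * R y) ≤ 1 := by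
  have hx := Φ_nonneg x
  have hx1 := sub_nonneg.2 (Φ_le_one x)
  rcases le_or_gt y 0 with hy | hy
  · have := mul_nonpos_of_nonpos_of_nonneg hy (mul_nonneg hx1 (R_nonneg y))
    linarith
  · have h1 : (1 - Φ x) * (y * R y) ≤ (1 - Φ y) * (y * R y) :=
      mul_le_mul_of_nonneg_right (by linarith [Φ_mono h]) (mul_nonneg hy.le (R_nonneg y))
    have h2 : (1 - Φ y) * (y * R y) ≤ Φ y := by
      rw [R, ← mul_div_assoc, ← mul_div_assoc, div_le_iff₀ (φ_pos y)]
      nlinarith [mul_one_sub_Φ_le y, Φ_nonneg y]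
    linarith [Φ_mono h]

/-- The solution of the Stein equation `f' - y f = 1_{y ≤ x} - Φ x`. -/
def steinSol (x y : ℝ) : ℝ := if y ≤ x then (1 - Φ x) * R y else Φ x * R (-y)

/-- The derivative of the solution of the Stein equation, as given by the equation. -/
def steinDeriv (x y : ℝ) : ℝ := y * steinSol x y + (if y ≤ x then 1 else 0) - Φ x

lemma steinSol_neg {x y : ℝ} (h : ¬y ≤ x) :
    steinSol x y = (1 - Φ (-x)) * R (-y) := by
  rw [steinSol, if_neg h, Φ_neg]; ring

lemma abs_steinSol_le (x y : ℝ) : |steinSol x y| ≤ √(2 * Real.pi) / 4 := by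
  by_cases h : y ≤ x
  · rw [steinSol, if_pos h, abs_of_nonneg (mul_nonneg (sub_nonneg.2 (Φ_le_one x)) (R_nonneg y))]
    exact one_sub_Φ_mul_R_le h
  · rw [steinSol_neg h, abs_of_nonneg (mul_nonneg (sub_nonneg.2 (Φ_le_one _)) (R_nonneg _))]
    exact one_sub_Φ_mul_R_le (by linarith)

lemma abs_steinDeriv_le (x y : ℝ) : |steinDeriv x y| ≤ 1 := by
  by_cases h : y ≤ x
  · have h1 : steinDeriv x y = (1 - Φ x) * (1 + y * R y) := by
      rw [steinDeriv, steinSol, if_pos h, if_pos h]; ring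
    rw [h1, abs_of_nonneg (mul_nonneg (sub_nonneg.2 (Φ_le_one x)) (one_add_mul_R_nonneg y))]
    exact one_sub_Φ_mul_one_add_le h
  · have h1 : steinDeriv x y = -((1 - Φ (-x)) * (1 + -y * R (-y))) := by
      rw [steinDeriv, steinSol_neg h, if_neg h, Φ_neg]; ring
    rw [h1, abs_neg,
      abs_of_nonneg (mul_nonneg (sub_nonneg.2 (Φ_le_one _)) (one_add_mul_R_nonneg _))]
    exact one_sub_Φ_mul_one_add_le (by linarith)

/-- The two branches agree at `y = x` by the reflection symmetry of Φ and φ. -/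
lemma continuous_steinSol (x : ℝ) : Continuous (steinSol x) := by
  refine Continuous.if_le (continuous_R.const_mul _)
    ((continuous_R.comp continuous_neg).const_mul _) continuous_id continuous_const ?_
  rintro y rfl
  simp only [R, Φ_neg, φ_neg]
  ring

lemma hasDerivAt_steinSol {x y : ℝ} (h : y ≠ x) :
    HasDerivAt (steinSol x) (steinDeriv x y) y := by
  rcases h.lt_or_gt with h | h
  · have h1 : HasDerivAt (fun y => (1 - Φ x) * R y) (steinDeriv x y) y := by
      refine HasDerivAt.congr_deriv ((hasDerivAt_R y).const_mul (1 - Φ x)) ?_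
      rw [steinDeriv, steinSol, if_pos h.le, if_pos h.le]; ring
    refine h1.congr_of_eventuallyEq ?_
    filter_upwards [Iio_mem_nhds h] with z hz
    rw [steinSol, if_pos (le_of_lt hz)]
  · have h1 : HasDerivAt (fun y => Φ x * R (-y)) (steinDeriv x y) y := by
      refine HasDerivAt.congr_deriv (((hasDerivAt_R (-y)).comp y (hasDerivAt_neg y)).const_mul (Φ x)) ?_
      rw [steinDeriv, steinSol, if_neg h.not_ge, if_neg h.not_ge]; ring
    refine h1.congr_of_eventuallyEq ?_
    filter_upwards [Ioi_mem_nhds h] with z hz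
    rw [steinSol, if_neg (not_le.2 hz)]

lemma intervalIntegrable_steinDeriv (x a b : ℝ) :
    IntervalIntegrable (steinDeriv x) volume a b := by
  refine (((continuous_id.mul (continuous_steinSol x)).intervalIntegrable a b).add ?_).sub
    (continuous_const.intervalIntegrable a b)
  have : Antitone fun y : ℝ => if y ≤ x then (1 : ℝ) else 0 := fun u v huv => by
    dsimp only
    split_ifs <;> linarith
  exact this.intervalIntegrable

/-- The solution is continuous and differentiable off the single point `x`, so the fundamental
theorem survives the jump of the derivative there. -/
lemma integral_steinDeriv (x a b : ℝ) :
    ∫ t in a..b, steinDeriv x t = steinSol x b - steinSol x a :=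
  integral_eq_of_hasDerivAt_off_countable _ _ (countable_singleton x)
    (continuous_steinSol x).continuousOn (fun _ ht => hasDerivAt_steinSol ht.2)
    (intervalIntegrable_steinDeriv x a b)

lemma abs_steinSol_sub_le (x a b : ℝ) : |steinSol x b - steinSol x a| ≤ |b - a| := by
  rw [← integral_steinDeriv]
  simpa using intervalIntegral.norm_integral_le_of_norm_le_const (f := steinDeriv x) (C := 1)
    (a := a) (b := b) fun t _ => abs_steinDeriv_le x t

/-- Substituting Stein's equation at `t` and at `a` splits the difference of derivatives into
(t-a)f(t), a(f(t)-f(a)) and an indicator jump. The bounds on f and its Lipschitz constant control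
the first two; integration over `t` gives the quadratic factor. -/
lemma abs_steinSol_sub_sub_le (x a b : ℝ) :
    |steinSol x b - steinSol x a - steinDeriv x a * (b - a)| ≤
      (|a| + √(2 * Real.pi) / 4) * ((b - a) ^ 2 / 2) +
        |b - a| * |(if a ≤ x then 1 else 0) - (if b ≤ x then 1 else 0)| := by
  set c := √(2 * Real.pi) / 4
  set K : ℝ := |(if a ≤ x then 1 else 0) - (if b ≤ x then 1 else 0)| with hK
  -- The sign makes |t - a| = s(t - a) on the whole interval, so the majorant is affine and can be
  -- integrated explicitly in either orientation.
  set s : ℝ := if a ≤ b then 1 else -1 with hs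
  have h1 : steinSol x b - steinSol x a - steinDeriv x a * (b - a) =
      ∫ t in a..b, (steinDeriv x t - steinDeriv x a) := by
    rw [intervalIntegral.integral_sub (intervalIntegrable_steinDeriv x a b) (by simp),
      integral_steinDeriv, intervalIntegral.integral_const, smul_eq_mul]
    ring
  have hb : ∀ t ∈ Ι a b, ‖steinDeriv x t - steinDeriv x a‖ ≤ (|a| + c) * (s * (t - a)) + K := by
    intro t ht
    have hst : s * (t - a) = |t - a| := by
      rcases mem_uIoc.1 ht with h | h
      · rw [hs, if_pos (h.1.le.trans h.2), abs_of_nonneg (by linarith)]; ring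
      · rw [hs, if_neg (by linarith), abs_of_nonpos (by linarith)]; ring
    have hind : |(if t ≤ x then (1 : ℝ) else 0) - (if a ≤ x then 1 else 0)| ≤ K := by
      rw [hK]
      rcases mem_uIoc.1 ht with h | h
      all_goals
        split_ifs <;> first | linarith | norm_num
    have h2 : steinDeriv x t - steinDeriv x a = (t - a) * steinSol x t +
        a * (steinSol x t - steinSol x a) +
        ((if t ≤ x then 1 else 0) - (if a ≤ x then 1 else 0)) := by
      simp only [steinDeriv]; ring
    rw [h2, hst, Real.norm_eq_abs]
    refine (abs_add_le _ _).trans (add_le_add ((abs_add_le _ _).trans ?_) hind)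
    rw [abs_mul, abs_mul]
    have h5 : |t - a| * |steinSol x t| ≤ |t - a| * c :=
      mul_le_mul_of_nonneg_left (abs_steinSol_le x t) (abs_nonneg _)
    have h6 := mul_le_mul_of_nonneg_left (abs_steinSol_sub_le x a t) (abs_nonneg a)
    linarith
  have h3 := intervalIntegral.norm_integral_le_abs_of_norm_le (a := a) (b := b) (μ := volume)
    ((ae_restrict_iff' measurableSet_uIoc).2 (.of_forall hb))
    (Continuous.intervalIntegrable (by fun_prop) _ _)
  rw [← h1, Real.norm_eq_abs] at h3
  refine h3.trans ?_
  have h4 : ∫ t in a..b, ((|a| + c) * (s * (t - a)) + K) =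
      (|a| + c) * s * ((b - a) ^ 2 / 2) + (b - a) * K := by
    rw [intervalIntegral.integral_add (Continuous.intervalIntegrable (by fun_prop) _ _)
      (by simp), intervalIntegral.integral_const_mul, intervalIntegral.integral_const_mul,
      intervalIntegral.integral_sub (by simp) (by simp), integral_id,
      intervalIntegral.integral_const, intervalIntegral.integral_const, smul_eq_mul, smul_eq_mul]
    ring
  rw [h4]
  refine (abs_add_le _ _).trans (add_le_add ?_ ?_)
  · have hs1 : |s| = 1 := by rw [hs]; split_ifs <;> simp
    have hc : 0 ≤ c := by positivity
    rw [abs_mul, abs_mul, hs1, mul_one, abs_of_nonneg (by positivity : 0 ≤ |a| + c),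
      abs_of_nonneg (by positivity : 0 ≤ (b - a) ^ 2 / 2)]
  · rw [abs_mul, abs_of_nonneg (abs_nonneg _ : 0 ≤ K)]

end StdNormal

namespace Rademacher

open Function StdNormal

variable {p : ℕ → I}

/-! ### Product rule and Skorohod integrals -/

/-- The normalized sign `X_l / √(p_l q_l)` in the product rule for the discrete gradient. -/
def sgn (p : ℕ → I) (l : ℕ) (ω : PathSpace) : ℝ := ((ω l : ℤ) : ℝ) / √(pq p l)

lemma sgn_sq (hp : ∀ k, 0 < p k ∧ p k < 1) (l : ℕ) (ω : PathSpace) :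
    sgn p l ω ^ 2 = 1 / pq p l := by
  rw [sgn, div_pow, Real.sq_sqrt (pq_pos hp l).le]
  rcases Int.units_eq_one_or (ω l) with h | h <;> simp [h]

/-- The gradient is a difference operator, so the Leibniz rule has a third term. Since `ω` itself is
one of the two updated paths, the sign of that term is the sign of the current coordinate. -/
lemma D_mul (hp : ∀ k, 0 < p k ∧ p k < 1) (l : ℕ) (a b : PathSpace → ℝ) (ω : PathSpace) :
    D p l (fun ω => a ω * b ω) ω =
      D p l a ω * b ω + a ω * D p l b ω - sgn p l ω * (D p l a ω * D p l b ω) := by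
  have hs0 : √(pq p l) ≠ 0 := (Real.sqrt_pos.2 (pq_pos hp l)).ne'
  rcases Int.units_eq_one_or (ω l) with h | h
  · have h1 : update ω l 1 = ω := by rw [← h, update_eq_self]
    simp only [D, sgn, h, h1]
    field_simp
    push_cast
    ring
  · have h1 : update ω l (-1) = ω := by rw [← h, update_eq_self]
    simp only [D, sgn, h, h1]
    field_simp
    push_cast
    ring

lemma D_finset_sum (l : ℕ) (s : Finset ℕ) (a : ℕ → PathSpace → ℝ) (ω : PathSpace) :
    D p l (fun ω => ∑ k ∈ s, a k ω) ω = ∑ k ∈ s, D p l (a k) ω := by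
  simp only [D, ← Finset.sum_sub_distrib, Finset.mul_sum]

lemma abs_D_abs_le (l : ℕ) (a : PathSpace → ℝ) (ω : PathSpace) :
    |D p l (fun ω => |a ω|) ω| ≤ |D p l a ω| := by
  simp only [D, abs_mul]
  exact mul_le_mul_of_nonneg_left (abs_abs_sub_abs_le_abs_sub _ _) (abs_nonneg _)

lemma D_Y_mul_self (hp : ∀ k, 0 < p k ∧ p k < 1) {k : ℕ} {u : PathSpace → ℝ}
    (hu : ∀ ω x, u (update ω k x) = u ω) : D p k (fun ω => Y p k ω * u ω) = u := by
  have hs : √(pq p k) ^ 2 = pq p k := Real.sq_sqrt (pq_pos hp k).le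
  have hs0 : √(pq p k) ≠ 0 := (Real.sqrt_pos.2 (pq_pos hp k)).ne'
  have h11 : (-1 : ℤˣ) ≠ 1 := by decide
  ext ω
  simp only [D, Y, hu, update_self, if_true, h11, if_false]
  field_simp
  ring

lemma D_Y_mul (k l : ℕ) (hkl : k ≠ l) (u : PathSpace → ℝ) :
    D p k (fun ω => Y p l ω * u ω) = fun ω => Y p l ω * D p k u ω := by
  ext ω
  simp only [D, Y, update_of_ne hkl.symm]
  ring

/-- Expand the square. On the diagonal one integration by parts gives E[u_k²]; off the diagonal two
give E[D_l u_k · D_k u_l], which is at most half the sum of the squares. -/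
lemma integral_sq_sum_Y_mul_le (hp : ∀ k, 0 < p k ∧ p k < 1) {N : Finset ℕ}
    {u : ℕ → PathSpace → ℝ} (hu : ∀ k, DependsOn (u k) (N : Set ℕ))
    (huk : ∀ k ω x, u k (update ω k x) = u k ω) :
    ∫ ω, (∑ k ∈ N, Y p k ω * u k ω) ^ 2 ∂law p ≤
      ∑ k ∈ N, ∫ ω, u k ω ^ 2 ∂law p + ∑ k ∈ N, ∑ l ∈ N, ∫ ω, D p l (u k) ω ^ 2 ∂law p := by
  have hY {k : ℕ} (hk : k ∈ N) : DependsOn (Y p k) (N : Set ℕ) := dependsOn_Y hk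
  have hsq {X : PathSpace → ℝ} (hX : DependsOn X (N : Set ℕ)) (c : ℝ) :
      Integrable (fun ω => c * X ω ^ 2) (law p) := (hX.comp₁ fun x => c * x ^ 2).integrable
  have hterm : ∀ k ∈ N, ∀ l ∈ N, ∫ ω, (Y p l ω * u l ω) * (Y p k ω * u k ω) ∂law p ≤
      (if k = l then ∫ ω, u k ω ^ 2 ∂law p else 0) + (1 / 2 * ∫ ω, D p l (u k) ω ^ 2 ∂law p +
        1 / 2 * ∫ ω, D p k (u l) ω ^ 2 ∂law p) := by
    intro k hk l hl
    rw [integral_mul_Y_mul hp hk ((hY hl).comp₂ (· * ·) (hu l)) (hu k) (huk k)]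
    have h0 (X : PathSpace → ℝ) : 0 ≤ ∫ ω, X ω ^ 2 ∂law p := integral_nonneg fun ω => sq_nonneg _
    by_cases hkl : k = l
    · subst hkl
      rw [D_Y_mul_self hp (huk k), if_pos rfl]
      have := h0 (D p k (u k))
      simp only [← sq]
      linarith
    · rw [D_Y_mul k l hkl, if_neg hkl, zero_add]
      have h1 := integral_mul_Y_mul hp hl (hu k) ((hu l).D (p := p) k) fun ω x => by
        simp only [D, update_comm (Ne.symm hkl), huk]
      simp only [mul_comm _ (u k _)]
      rw [h1, ← integral_const_mul, ← integral_const_mul,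
        ← integral_add (hsq ((hu k).D l) _) (hsq ((hu l).D k) _)]
      exact integral_mono (((hu k).D l).comp₂ (· * ·) ((hu l).D k)).integrable
        ((hsq ((hu k).D l) _).add (hsq ((hu l).D k) _))
        fun ω => by nlinarith [sq_nonneg (D p l (u k) ω - D p k (u l) ω)]
  have hint {k l : ℕ} (hk : k ∈ N) (hl : l ∈ N) :
      Integrable (fun ω => (Y p l ω * u l ω) * (Y p k ω * u k ω)) (law p) :=
    (((hY hl).comp₂ (· * ·) (hu l)).comp₂ (· * ·) ((hY hk).comp₂ (· * ·) (hu k))).integrable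
  calc ∫ ω, (∑ k ∈ N, Y p k ω * u k ω) ^ 2 ∂law p
      = ∑ l ∈ N, ∑ k ∈ N, ∫ ω, (Y p l ω * u l ω) * (Y p k ω * u k ω) ∂law p := by
        simp only [sq, Finset.sum_mul_sum]
        rw [integral_finsetSum _ fun l hl => integrable_finsetSum _ fun k hk => hint hk hl]
        exact Finset.sum_congr rfl fun l hl => integral_finsetSum _ fun k hk => hint hk hl
    _ ≤ ∑ l ∈ N, ∑ k ∈ N, ((if k = l then ∫ ω, u k ω ^ 2 ∂law p else 0) +
          (1 / 2 * ∫ ω, D p l (u k) ω ^ 2 ∂law p + 1 / 2 * ∫ ω, D p k (u l) ω ^ 2 ∂law p)) :=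
        Finset.sum_le_sum fun l hl => Finset.sum_le_sum fun k hk => hterm k hk l hl
    _ = _ := by
        simp only [Finset.sum_add_distrib, ← Finset.mul_sum]
        rw [Finset.sum_comm (f := fun l k => ∫ ω, D p l (u k) ω ^ 2 ∂law p)]
        have : ∀ l ∈ N, ∑ k ∈ N, (if k = l then ∫ ω, u k ω ^ 2 ∂law p else 0) =
            ∫ ω, u l ω ^ 2 ∂law p := fun l hl => by simp [hl]
        rw [Finset.sum_congr rfl this]
        ring

lemma integral_sub_mean_sq {N : Finset ℕ} {W : PathSpace → ℝ} (hW : DependsOn W (N : Set ℕ)) :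
    ∫ ω, (W ω - ∫ ω', W ω' ∂law p) ^ 2 ∂law p =
      ∫ ω, W ω ^ 2 ∂law p - (∫ ω, W ω ∂law p) ^ 2 := by
  set m := ∫ ω', W ω' ∂law p
  have h1 : Integrable (fun ω => W ω ^ 2) (law p) := (hW.comp₁ (· ^ 2)).integrable
  have h2 : Integrable (fun ω => 2 * m * W ω) (law p) := hW.integrable.const_mul _
  have : ∀ ω, (W ω - m) ^ 2 = W ω ^ 2 - 2 * m * W ω + m ^ 2 := fun ω => by ring
  simp only [this]
  rw [integral_add (by exact h1.sub h2) (integrable_const _), integral_sub h1 h2,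
    integral_const_mul]
  simp [m]
  ring

/-- The variance of |W| is nonnegative. -/
lemma integral_abs_le_sqrt {N : Finset ℕ} {W : PathSpace → ℝ} (hW : DependsOn W (N : Set ℕ)) :
    ∫ ω, |W ω| ∂law p ≤ √(∫ ω, W ω ^ 2 ∂law p) := by
  refine Real.le_sqrt_of_sq_le ?_
  have h := integral_sub_mean_sq (p := p) (hW.comp₁ fun x => |x|)
  have h0 : 0 ≤ ∫ ω, (|W ω| - ∫ ω', |W ω'| ∂law p) ^ 2 ∂law p :=
    integral_nonneg fun ω => sq_nonneg _
  simp only [sq_abs] at h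
  linarith

/-! ### Stein's method for functionals of finitely many coordinates -/

/-- The indicator of the half-line `(x, ∞)`. -/
def above (x y : ℝ) : ℝ := if y ≤ x then 0 else 1

lemma above_mono (x : ℝ) : Monotone (above x) := fun u v huv => by
  unfold above
  split_ifs <;> linarith

/-- Since `above x` is monotone, its increment has the same sign as `b - a`. The jump term is thus
linear in the increment of the indicator, without absolute values, and so becomes accessible to
integration by parts. -/
lemma abs_steinSol_sub_sub_le_above {s : ℝ} (hs : 0 < s) (x a b : ℝ) :
    |s * (steinSol x b - steinSol x a) - steinDeriv x a * (s * (b - a))| ≤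
      (|a| + √(2 * Real.pi) / 4) * ((s * (b - a)) ^ 2 / (2 * s)) +
        s * (b - a) * (s * (above x b - above x a)) / s := by
  have h1 : (if a ≤ x then (1 : ℝ) else 0) - (if b ≤ x then 1 else 0) = above x b - above x a := by
    unfold above; split_ifs <;> norm_num
  have h2 : 0 ≤ (b - a) * (above x b - above x a) := by
    rcases le_total a b with h | h
    · exact mul_nonneg (sub_nonneg.2 h) (sub_nonneg.2 (above_mono x h))
    · exact mul_nonneg_of_nonpos_of_nonpos (sub_nonpos.2 h) (sub_nonpos.2 (above_mono x h))
  have h := mul_le_mul_of_nonneg_left (abs_steinSol_sub_sub_le x a b) hs.le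
  rw [h1, ← abs_mul (b - a), abs_of_nonneg h2] at h
  calc _ = s * |steinSol x b - steinSol x a - steinDeriv x a * (b - a)| := by
        rw [← abs_of_pos hs, ← abs_mul, abs_of_pos hs]; ring_nf
    _ ≤ _ := h
    _ = _ := by field_simp

lemma abs_D_steinSol_sub_le (hp : ∀ k, 0 < p k ∧ p k < 1) (x : ℝ) (k : ℕ) (G : PathSpace → ℝ)
    (ω : PathSpace) :
    |D p k (fun ω => steinSol x (G ω)) ω - steinDeriv x (G ω) * D p k G ω| ≤
      (|G ω| + √(2 * Real.pi) / 4) * (D p k G ω ^ 2 / (2 * √(pq p k))) +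
        D p k G ω * D p k (fun ω => above x (G ω)) ω / √(pq p k) := by
  have hs : 0 < √(pq p k) := Real.sqrt_pos.2 (pq_pos hp k)
  rcases Int.units_eq_one_or (ω k) with h | h
  · have h1 : update ω k 1 = ω := by rw [← h, update_eq_self]
    simp only [D, h1]
    have := abs_steinSol_sub_sub_le_above hs x (G ω) (G (update ω k (-1)))
    rw [← abs_neg]
    convert this using 1
    · congr 1; ring
    · ring
  · have h1 : update ω k (-1) = ω := by rw [← h, update_eq_self]
    simp only [D, h1]
    exact abs_steinSol_sub_sub_le_above hs x (G ω) (G (update ω k 1))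

/-- Stein's method for `G = E[F | N]`. -/
lemma abs_integral_sub_Φ_le (hp : ∀ k, 0 < p k ∧ p k < 1) {N : Finset ℕ} {F : PathSpace → ℝ}
    (hF : Integrable F (law p)) (hF0 : ∫ ω, F ω ∂law p = 0) (x : ℝ)
    {G : PathSpace → ℝ} (hG : G = condE p N F)
    {Z : PathSpace → ℝ} (hZ : Z = fun ω => ∑ k ∈ N, D p k G ω * dInv p N k F ω)
    {u : ℕ → PathSpace → ℝ}
    (hu : u = fun k ω => 1 / √(pq p k) * (D p k G ω * |dInv p N k F ω|)) :
    |∫ ω, (if G ω ≤ x then 1 else 0) ∂law p - Φ x| ≤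
      |1 - ∫ ω, G ω ^ 2 ∂law p| + √(∑ l ∈ N, ∫ ω, D p l Z ω ^ 2 ∂law p) +
      √(2 * Real.pi) / 8 * ∑ k ∈ N, 1 / √(pq p k) *
        ∫ ω, D p k G ω ^ 2 * |dInv p N k F ω| ∂law p +
      1 / 2 * ∑ k ∈ N, 1 / √(pq p k) *
        ∫ ω, |G ω| * (D p k G ω ^ 2 * |dInv p N k F ω|) ∂law p +
      √(∑ k ∈ N, ∫ ω, u k ω ^ 2 ∂law p + ∑ k ∈ N, ∑ l ∈ N, ∫ ω, D p l (u k) ω ^ 2 ∂law p) := by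
  have dG : DependsOn G (N : Set ℕ) := hG ▸ dependsOn_condE N F
  have dA (k : ℕ) : DependsOn (dInv p N k F) (N : Set ℕ) := dependsOn_dInv N k F
  have dZ : DependsOn Z (N : Set ℕ) := hZ ▸ .sum fun k _ => (dG.D k).comp₂ (· * ·) (dA k)
  have du (k : ℕ) : DependsOn (u k) (N : Set ℕ) :=
    hu ▸ (dG.D k).comp₂ (fun a b => 1 / √(pq p k) * (a * |b|)) (dA k)
  have huk (k : ℕ) (ω : PathSpace) (x : ℤˣ) : u k (update ω k x) = u k ω := by
    simp only [hu, D_update, dInv_update]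
  have hcov (H : PathSpace → ℝ) (dH : DependsOn H (N : Set ℕ)) :
      ∫ ω, H ω * G ω ∂law p = ∑ k ∈ N, ∫ ω, D p k H ω * dInv p N k F ω ∂law p := by
    rw [← covariance_eq hp hF dH, hF0, mul_zero, sub_zero, hG]
  set J : PathSpace → ℝ := fun ω => above x (G ω)
  have dJ : DependsOn J (N : Set ℕ) := dG.comp₁ _
  set S : PathSpace → ℝ := fun ω => steinSol x (G ω)
  have dS : DependsOn S (N : Set ℕ) := dG.comp₁ _
  set S' : PathSpace → ℝ := fun ω => steinDeriv x (G ω)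
  have dS' : DependsOn S' (N : Set ℕ) := dG.comp₁ _
  -- the Stein equation
  have h1 : ∫ ω, (if G ω ≤ x then 1 else 0) ∂law p - Φ x =
      ∫ ω, S' ω ∂law p - ∫ ω, S ω * G ω ∂law p := by
    have hI : Integrable (fun ω => if G ω ≤ x then (1 : ℝ) else 0) (law p) :=
      (dG.comp₁ fun y => if y ≤ x then (1 : ℝ) else 0).integrable
    rw [← integral_sub dS'.integrable (dS.comp₂ (· * ·) dG).integrable]
    have : ∀ ω, S' ω - S ω * G ω = (if G ω ≤ x then 1 else 0) - Φ x := fun ω => by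
      simp only [S', S, steinDeriv]; ring
    simp only [this]
    rw [integral_sub hI (integrable_const _)]
    simp
  -- The covariance identity with `G` against itself: the mean of `Z` is the second moment of `G`,
  -- so 1 - Z splits into the variance defect and a centred fluctuation.
  have hmean : ∫ ω, Z ω ∂law p = ∫ ω, G ω ^ 2 ∂law p := by
    simp only [sq]
    rw [hcov G dG, hZ, integral_finsetSum _ fun k _ => ((dG.D k).comp₂ (· * ·) (dA k)).integrable]
  have h2 : ∫ ω, S' ω ∂law p - ∫ ω, S ω * G ω ∂law p = ∫ ω, S' ω * (1 - Z ω) ∂law p -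
      ∑ k ∈ N, ∫ ω, (D p k S ω - S' ω * D p k G ω) * dInv p N k F ω ∂law p := by
    have i1 (k : ℕ) : Integrable (fun ω => D p k S ω * dInv p N k F ω) (law p) :=
      ((dS.D k).comp₂ (· * ·) (dA k)).integrable
    have i2 (k : ℕ) : Integrable (fun ω => S' ω * (D p k G ω * dInv p N k F ω)) (law p) :=
      (dS'.comp₂ (· * ·) ((dG.D k).comp₂ (· * ·) (dA k))).integrable
    have : ∀ k ∈ N, ∫ ω, (D p k S ω - S' ω * D p k G ω) * dInv p N k F ω ∂law p =
        ∫ ω, D p k S ω * dInv p N k F ω ∂law p -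
          ∫ ω, S' ω * (D p k G ω * dInv p N k F ω) ∂law p := fun k _ => by
      rw [← integral_sub (i1 k) (i2 k)]
      exact integral_congr_ae (.of_forall fun ω => by ring)
    rw [Finset.sum_congr rfl this, Finset.sum_sub_distrib, ← hcov S dS,
      ← integral_finsetSum _ fun k _ => i2 k]
    simp only [← Finset.mul_sum, mul_sub, mul_one]
    rw [integral_sub dS'.integrable, hZ]
    · ring
    · exact (dS'.comp₂ (· * ·) dZ).integrable
  -- the leading term
  have h3 : |∫ ω, S' ω * (1 - Z ω) ∂law p| ≤
      |1 - ∫ ω, G ω ^ 2 ∂law p| + √(∑ l ∈ N, ∫ ω, D p l Z ω ^ 2 ∂law p) := by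
    have dW : DependsOn (fun ω => Z ω - ∫ ω', Z ω' ∂law p) (N : Set ℕ) :=
      dZ.comp₁ (· - _)
    calc |∫ ω, S' ω * (1 - Z ω) ∂law p|
        ≤ ∫ ω, (|1 - ∫ ω', Z ω' ∂law p| + |Z ω - ∫ ω', Z ω' ∂law p|) ∂law p := by
          refine (Real.norm_eq_abs _).symm.le.trans (norm_integral_le_of_norm_le
            (dZ.comp₁ fun z => |1 - ∫ ω', Z ω' ∂law p| + |z - ∫ ω', Z ω' ∂law p|).integrable
            (.of_forall fun ω => ?_))
          rw [norm_mul, Real.norm_eq_abs, Real.norm_eq_abs]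
          refine (mul_le_of_le_one_left (abs_nonneg _) (abs_steinDeriv_le x (G ω))).trans ?_
          rw [abs_sub_comm (Z ω)]
          exact abs_sub_le _ _ _
      _ = |1 - ∫ ω, G ω ^ 2 ∂law p| + ∫ ω, |Z ω - ∫ ω', Z ω' ∂law p| ∂law p := by
          rw [integral_add (integrable_const _) (dW.comp₁ fun x => |x|).integrable]
          simp [hmean]
      _ ≤ _ := by
          gcongr
          refine (integral_abs_le_sqrt dW).trans (Real.sqrt_le_sqrt ?_)
          rw [integral_sub_mean_sq dZ]
          exact variance_le hp dZ
  -- the remainder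
  have h4 : ∀ k ∈ N, |∫ ω, (D p k S ω - S' ω * D p k G ω) * dInv p N k F ω ∂law p| ≤
      √(2 * Real.pi) / 8 * (1 / √(pq p k) * ∫ ω, D p k G ω ^ 2 * |dInv p N k F ω| ∂law p) +
      1 / 2 * (1 / √(pq p k) * ∫ ω, |G ω| * (D p k G ω ^ 2 * |dInv p N k F ω|) ∂law p) +
      ∫ ω, D p k J ω * u k ω ∂law p := fun k _ => by
    have d1 : DependsOn (fun ω => D p k G ω ^ 2 * |dInv p N k F ω|) (N : Set ℕ) :=
      (dG.D k).comp₂ (fun a b => a ^ 2 * |b|) (dA k)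
    have d2 : DependsOn (fun ω => |G ω| * (D p k G ω ^ 2 * |dInv p N k F ω|)) (N : Set ℕ) :=
      dG.comp₂ (fun a b => |a| * b) d1
    have i3 : Integrable (fun ω => D p k J ω * u k ω) (law p) :=
      ((dJ.D k).comp₂ (· * ·) (du k)).integrable
    have i1 := (d1.integrable.const_mul (1 / √(pq p k))).const_mul (√(2 * Real.pi) / 8) (μ := law p)
    have i2 := (d2.integrable.const_mul (1 / √(pq p k))).const_mul (1 / 2) (μ := law p)
    have i12 := i1.add i2
    simp only [Pi.add_def] at i12
    rw [← integral_const_mul, ← integral_const_mul, ← integral_const_mul, ← integral_const_mul,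
      ← integral_add i1 i2, ← integral_add i12 i3]
    refine (Real.norm_eq_abs _).symm.le.trans
      (norm_integral_le_of_norm_le (i12.add i3) (.of_forall fun ω => ?_))
    rw [norm_mul, Real.norm_eq_abs, Real.norm_eq_abs]
    refine (mul_le_mul_of_nonneg_right (abs_D_steinSol_sub_le hp x k G ω)
      (abs_nonneg _)).trans (le_of_eq ?_)
    have hs : √(pq p k) ≠ 0 := (Real.sqrt_pos.2 (pq_pos hp k)).ne'
    simp only [hu, J]
    field_simp
    ring
  -- Moving the gradient off the indicator gives E[J · ∑ Y_k u_k]. As 0 ≤ J ≤ 1, this is at most the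
  -- L¹ norm of the Skorohod integral, hence at most its L² norm.
  have h5 : ∑ k ∈ N, ∫ ω, D p k J ω * u k ω ∂law p ≤
      √(∑ k ∈ N, ∫ ω, u k ω ^ 2 ∂law p + ∑ k ∈ N, ∑ l ∈ N, ∫ ω, D p l (u k) ω ^ 2 ∂law p) := by
    have dY : DependsOn (fun ω => ∑ k ∈ N, Y p k ω * u k ω) (N : Set ℕ) :=
      .sum fun k hk => (dependsOn_Y hk).comp₂ (· * ·) (du k)
    rw [Finset.sum_congr rfl fun k hk => (integral_mul_Y_mul hp hk dJ (du k) (huk k)).symm,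
      ← integral_finsetSum _ fun k hk =>
        (dJ.comp₂ (· * ·) ((dependsOn_Y hk).comp₂ (· * ·) (du k))).integrable]
    simp only [← Finset.mul_sum]
    refine le_trans ?_ ((integral_abs_le_sqrt dY).trans
      (Real.sqrt_le_sqrt (integral_sq_sum_Y_mul_le hp du huk)))
    refine integral_mono (dJ.comp₂ (· * ·) dY).integrable (dY.comp₁ fun x => |x|).integrable
      fun ω => ?_
    have hJ : 0 ≤ J ω ∧ J ω ≤ 1 := by simp only [J, above]; split_ifs <;> norm_num
    exact (mul_le_mul_of_nonneg_left (le_abs_self _) hJ.1).trans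
      (mul_le_of_le_one_left (abs_nonneg _) hJ.2)
  rw [h1, h2]
  refine (abs_sub _ _).trans ?_
  have h6 := (Finset.abs_sum_le_sum_abs _ _).trans (Finset.sum_le_sum h4)
  rw [Finset.sum_add_distrib, Finset.sum_add_distrib, ← Finset.mul_sum, ← Finset.mul_sum] at h6
  linarith

/-! ### Moment estimates -/

lemma expect_mono {X Y : PathSpace → ℝ} (h : ∀ ω, X ω ≤ Y ω) : expect p X ≤ expect p Y :=
  lintegral_mono fun ω => ENNReal.ofReal_le_ofReal (h ω)

lemma expect_const_mul {c : ℝ} (hc : 0 ≤ c) {X : PathSpace → ℝ} :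
    expect p (fun ω => c * X ω) = ENNReal.ofReal c * expect p X := by
  simp only [expect, ENNReal.ofReal_mul hc]
  exact lintegral_const_mul' _ _ ENNReal.ofReal_ne_top

lemma expect_add {X Y : PathSpace → ℝ} (hX : Measurable X) (hX0 : ∀ ω, 0 ≤ X ω)
    (hY0 : ∀ ω, 0 ≤ Y ω) : expect p (fun ω => X ω + Y ω) = expect p X + expect p Y := by
  simp only [expect, ENNReal.ofReal_add (hX0 _) (hY0 _)]
  exact lintegral_add_left hX.ennreal_ofReal _

lemma expect_sum {s : Finset (Finset ℕ)} {X : Finset ℕ → PathSpace → ℝ}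
    (hX : ∀ i ∈ s, Measurable (X i)) (hX0 : ∀ i ω, 0 ≤ X i ω) :
    expect p (fun ω => ∑ i ∈ s, X i ω) = ∑ i ∈ s, expect p (X i) := by
  simp only [expect, ENNReal.ofReal_sum_of_nonneg fun i _ => hX0 i _]
  exact lintegral_finsetSum' _ fun i hi => (hX i hi).ennreal_ofReal.aemeasurable

lemma expect_dInv_rpow_le {F : PathSpace → ℝ} (hF : Measurable F) (N : Finset ℕ) (k : ℕ) {t : ℝ}
    (ht : 1 ≤ t) : expect p (fun ω => |dInv p N k F ω| ^ t) ≤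
      expect p (fun ω => |D p k F ω| ^ t) := by
  have h0 : 0 ≤ t := zero_le_one.trans ht
  calc expect p (fun ω => |dInv p N k F ω| ^ t)
      ≤ expect p (fun ω => ∑ S ∈ N.powerset, weight N S * |condE p S (D p k F) ω| ^ t) := by
        refine expect_mono fun ω => le_trans ?_ (Real.rpow_arith_mean_le_arith_mean_rpow _ _
          (fun S => |condE p S (D p k F) ω|) (fun S _ => weight_nonneg N S) (sum_weight N)
          (fun S _ => abs_nonneg _) ht)
        refine Real.rpow_le_rpow (abs_nonneg _) ((Finset.abs_sum_le_sum_abs _ _).trans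
          (le_of_eq (Finset.sum_congr rfl fun S _ => ?_))) h0
        rw [abs_mul, abs_of_nonneg (weight_nonneg N S)]
    _ = ∑ S ∈ N.powerset, ENNReal.ofReal (weight N S) *
          expect p (fun ω => |condE p S (D p k F) ω| ^ t) := by
        rw [expect_sum (fun S _ => (measurable_condE.abs.pow_const t).const_mul _)
          fun S ω => mul_nonneg (weight_nonneg N S) (Real.rpow_nonneg (abs_nonneg _) _)]
        exact Finset.sum_congr rfl fun S _ => expect_const_mul (weight_nonneg N S)
    _ ≤ ∑ S ∈ N.powerset, ENNReal.ofReal (weight N S) * expect p (fun ω => |D p k F ω| ^ t) :=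
        Finset.sum_le_sum fun S _ => mul_le_mul_right
          (expect_condE_rpow_le (measurable_D hF k) S ht) _
    _ = expect p (fun ω => |D p k F ω| ^ t) := by
        rw [← Finset.sum_mul, ← ENNReal.ofReal_sum_of_nonneg fun S _ => weight_nonneg N S,
          sum_weight, ENNReal.ofReal_one, one_mul]

lemma ofReal_sq (x : ℝ) : ENNReal.ofReal (x ^ 2) = ‖x‖ₑ ^ 2 := by
  rw [← sq_abs, ENNReal.ofReal_pow (abs_nonneg x), Real.enorm_eq_ofReal_abs]

lemma expect_sq_mul_sq (X Y : PathSpace → ℝ) :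
    expect p (fun ω => X ω ^ 2 * Y ω ^ 2) = ∫⁻ ω, (‖X ω‖ₑ * ‖Y ω‖ₑ) ^ 2 ∂law p := by
  simp only [expect, ENNReal.ofReal_mul (sq_nonneg _), ofReal_sq, mul_pow]

lemma rpow_half_mul_rpow_half (a : ℝ≥0∞) : a ^ (1 / 2 : ℝ) * a ^ (1 / 2 : ℝ) = a := by
  rw [← ENNReal.rpow_add_of_nonneg _ _ (by norm_num) (by norm_num)]
  norm_num

/-- Jensen's inequality for independent extensions, followed by the Cauchy-Schwarz inequality. -/
lemma expect_sq_sum_condE_mul_le (hp : ∀ k, 0 < p k ∧ p k < 1) (K N S : Finset ℕ)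
    {X Y : ℕ → PathSpace → ℝ} (hX : ∀ k, Measurable (X k)) (hY : ∀ k, Measurable (Y k))
    (hXi : ∀ k, Integrable (X k) (law p)) (hYi : ∀ k, Integrable (Y k) (law p)) :
    expect p (fun ω => (∑ k ∈ K, condE p N (X k) ω * condE p S (Y k) ω) ^ 2) ≤
      ∑ j ∈ K, ∑ k ∈ K, expect p (fun ω => X j ω ^ 2 * X k ω ^ 2) ^ (1 / 2 : ℝ) *
        expect p (fun ω => Y j ω ^ 2 * Y k ω ^ 2) ^ (1 / 2 : ℝ) := by
  set ν := (law p).prod (law p)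
  -- The two averages use independent copies of the outside coordinates but share `ω`, so their
  -- product is a single integral. Each resampled path separately has law `law p`, which is all that
  -- Cauchy–Schwarz requires.
  set π₁ : PathSpace × PathSpace × PathSpace → PathSpace := fun z => N.piecewise z.1 z.2.1
  set π₂ : PathSpace × PathSpace × PathSpace → PathSpace := fun z => S.piecewise z.1 z.2.2
  have hπ₁ : MeasurePreserving π₁ ((law p).prod ν) (law p) :=
    (measurePreserving_piecewise N).comp ((MeasurePreserving.id _).prod measurePreserving_fst)
  have hπ₂ : MeasurePreserving π₂ ((law p).prod ν) (law p) :=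
    (measurePreserving_piecewise S).comp ((MeasurePreserving.id _).prod measurePreserving_snd)
  have hmX (j k : ℕ) : Measurable fun ω => ‖X j ω‖ₑ * ‖X k ω‖ₑ := (hX j).enorm.mul (hX k).enorm
  have hmY (j k : ℕ) : Measurable fun ω => ‖Y j ω‖ₑ * ‖Y k ω‖ₑ := (hY j).enorm.mul (hY k).enorm
  have h1 (ω : PathSpace) : ENNReal.ofReal
      ((∑ k ∈ K, condE p N (X k) ω * condE p S (Y k) ω) ^ 2) ≤
      ∫⁻ z, ∑ j ∈ K, ∑ k ∈ K, (‖X j (π₁ (ω, z))‖ₑ * ‖X k (π₁ (ω, z))‖ₑ) *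
        (‖Y j (π₂ (ω, z))‖ₑ * ‖Y k (π₂ (ω, z))‖ₑ) ∂ν := by
    have hi (k : ℕ) : Integrable (fun z : PathSpace × PathSpace =>
        X k (π₁ (ω, z)) * Y k (π₂ (ω, z))) ν :=
      ((hXi k).comp_piecewise hp N ω).mul_prod ((hYi k).comp_piecewise hp S ω)
    have h2 : ∑ k ∈ K, condE p N (X k) ω * condE p S (Y k) ω =
        ∫ z, ∑ k ∈ K, X k (π₁ (ω, z)) * Y k (π₂ (ω, z)) ∂ν := by
      rw [integral_finsetSum _ fun k _ => hi k]
      exact Finset.sum_congr rfl fun k _ => (integral_prod_mul (μ := law p) (ν := law p)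
        (fun ω' => X k (N.piecewise ω ω')) fun ω' => Y k (S.piecewise ω ω')).symm
    have h3 := enorm_integral_rpow_le (μ := ν)
      (integrable_finsetSum K fun k _ => hi k).aestronglyMeasurable one_le_two
    simp only [ENNReal.rpow_two] at h3
    rw [ofReal_sq, h2]
    refine h3.trans (lintegral_mono fun z => ?_)
    calc _ ≤ (∑ k ∈ K, ‖X k (π₁ (ω, z))‖ₑ * ‖Y k (π₂ (ω, z))‖ₑ) ^ 2 := by
          refine pow_le_pow_left₀ zero_le ((enorm_sum_le _ _).trans (le_of_eq ?_)) 2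
          simp only [enorm_mul]
      _ = _ := by
          rw [sq, Finset.sum_mul_sum]
          exact Finset.sum_congr rfl fun j _ => Finset.sum_congr rfl fun k _ => by ring
  have hm : Measurable fun z => ∑ j ∈ K, ∑ k ∈ K, (‖X j (π₁ z)‖ₑ * ‖X k (π₁ z)‖ₑ) *
        (‖Y j (π₂ z)‖ₑ * ‖Y k (π₂ z)‖ₑ) :=
    Finset.measurable_fun_sum _ fun j _ => Finset.measurable_fun_sum _ fun k _ =>
      ((hmX j k).comp hπ₁.measurable).mul ((hmY j k).comp hπ₂.measurable)
  calc _ ≤ ∫⁻ ω, ∫⁻ z, ∑ j ∈ K, ∑ k ∈ K, (‖X j (π₁ (ω, z))‖ₑ * ‖X k (π₁ (ω, z))‖ₑ) *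
        (‖Y j (π₂ (ω, z))‖ₑ * ‖Y k (π₂ (ω, z))‖ₑ) ∂ν ∂law p := lintegral_mono h1
    _ = ∑ j ∈ K, ∑ k ∈ K, ∫⁻ z, (‖X j (π₁ z)‖ₑ * ‖X k (π₁ z)‖ₑ) *
        (‖Y j (π₂ z)‖ₑ * ‖Y k (π₂ z)‖ₑ) ∂((law p).prod ν) := by
        rw [← lintegral_prod (fun z => ∑ j ∈ K, ∑ k ∈ K, (‖X j (π₁ z)‖ₑ * ‖X k (π₁ z)‖ₑ) *
          (‖Y j (π₂ z)‖ₑ * ‖Y k (π₂ z)‖ₑ)) hm.aemeasurable, lintegral_finsetSum]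
        · refine Finset.sum_congr rfl fun j _ => lintegral_finsetSum _ fun k _ => ?_
          exact ((hmX j k).comp hπ₁.measurable).mul ((hmY j k).comp hπ₂.measurable)
        · exact fun j _ => Finset.measurable_fun_sum _ fun k _ =>
            ((hmX j k).comp hπ₁.measurable).mul ((hmY j k).comp hπ₂.measurable)
    _ ≤ _ := by
        refine Finset.sum_le_sum fun j _ => Finset.sum_le_sum fun k _ => ?_
        have := ENNReal.lintegral_mul_le_Lp_mul_Lq ((law p).prod ν) Real.HolderConjugate.two_two
          ((hmX j k).comp hπ₁.measurable).aemeasurable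
          ((hmY j k).comp hπ₂.measurable).aemeasurable
        refine this.trans (le_of_eq ?_)
        simp only [ENNReal.rpow_two, comp_apply, expect_sq_mul_sq]
        rw [← hπ₁.lintegral_comp ((hmX j k).pow_const 2),
          ← hπ₂.lintegral_comp ((hmY j k).pow_const 2)]

/-- Cauchy–Schwarz over the random set costs its total mass `W` once, and summing the bound, which
is uniform in `S`, costs `W` again. The value W = 1 serves undifferentiated `dInv` and W = 1/2 its
gradient. -/
lemma expect_sq_sum_condE_mul_sum_le (hp : ∀ k, 0 < p k ∧ p k < 1) (K N : Finset ℕ)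
    {w : Finset ℕ → ℝ} (hw : ∀ S, 0 ≤ w S) {W : ℝ} (hW : ∑ S ∈ N.powerset, w S = W)
    {X Y : ℕ → PathSpace → ℝ} (hX : ∀ k, Measurable (X k)) (hY : ∀ k, Measurable (Y k))
    (hXi : ∀ k, Integrable (X k) (law p)) (hYi : ∀ k, Integrable (Y k) (law p)) :
    expect p (fun ω => (∑ k ∈ K, condE p N (X k) ω *
        ∑ S ∈ N.powerset, w S * condE p S (Y k) ω) ^ 2) ≤
      ENNReal.ofReal (W ^ 2) *
      ∑ j ∈ K, ∑ k ∈ K, expect p (fun ω => X j ω ^ 2 * X k ω ^ 2) ^ (1 / 2 : ℝ) *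
        expect p (fun ω => Y j ω ^ 2 * Y k ω ^ 2) ^ (1 / 2 : ℝ) := by
  have hW0 : 0 ≤ W := hW ▸ Finset.sum_nonneg fun S _ => hw S
  set B := ∑ j ∈ K, ∑ k ∈ K, expect p (fun ω => X j ω ^ 2 * X k ω ^ 2) ^ (1 / 2 : ℝ) *
        expect p (fun ω => Y j ω ^ 2 * Y k ω ^ 2) ^ (1 / 2 : ℝ)
  set T : Finset ℕ → PathSpace → ℝ := fun S ω =>
    ∑ k ∈ K, condE p N (X k) ω * condE p S (Y k) ω
  have hT (S : Finset ℕ) : Measurable (T S) :=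
    Finset.measurable_fun_sum _ fun k _ => measurable_condE.mul measurable_condE
  calc _ ≤ expect p (fun ω => W * ∑ S ∈ N.powerset, w S * T S ω ^ 2) := by
        refine expect_mono fun ω => ?_
        have h1 : ∑ k ∈ K, condE p N (X k) ω * ∑ S ∈ N.powerset, w S * condE p S (Y k) ω =
            ∑ S ∈ N.powerset, w S * T S ω := by
          simp only [T, Finset.mul_sum]
          rw [Finset.sum_comm]
          exact Finset.sum_congr rfl fun S _ => Finset.sum_congr rfl fun k _ => by ring
        rw [h1, ← hW]
        exact Finset.sum_sq_le_sum_mul_sum_of_sq_le_mul _ (fun S _ => hw S)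
          (fun S _ => mul_nonneg (hw S) (sq_nonneg _)) fun S _ => (by ring : _ = _).le
    _ = ENNReal.ofReal W * ∑ S ∈ N.powerset, ENNReal.ofReal (w S) *
          expect p (fun ω => T S ω ^ 2) := by
        rw [expect_const_mul hW0, expect_sum (fun S _ => ((hT S).pow_const 2).const_mul _)
          fun S ω => mul_nonneg (hw S) (sq_nonneg _)]
        congr 1
        exact Finset.sum_congr rfl fun S _ => expect_const_mul (hw S)
    _ ≤ ENNReal.ofReal W * ∑ S ∈ N.powerset, ENNReal.ofReal (w S) * B := by
        gcongr with S hS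
        exact expect_sq_sum_condE_mul_le hp K N S hX hY hXi hYi
    _ = _ := by
        rw [← Finset.sum_mul, ← ENNReal.ofReal_sum_of_nonneg fun S _ => hw S, hW, ← mul_assoc,
          ← ENNReal.ofReal_mul hW0, sq]

/-! ### Second moments of the leading term and of the Skorohod integrand -/

lemma sq_add_sub_le (a b c s : ℝ) :
    (a + b - s * c) ^ 2 ≤ 3 * (a ^ 2 + b ^ 2 + s ^ 2 * c ^ 2) := by
  nlinarith [sq_nonneg (a - b), sq_nonneg (a + s * c), sq_nonneg (b + s * c)]

lemma expect_three_mul_add_le {a b c : PathSpace → ℝ} (ha : Measurable a) (hb : Measurable b)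
    {d : ℝ} (hd : 0 ≤ d) {A B C : ℝ≥0∞}
    (hA : expect p (fun ω => a ω ^ 2) ≤ A) (hB : expect p (fun ω => b ω ^ 2) ≤ B)
    (hC : expect p (fun ω => c ω ^ 2) ≤ C) :
    expect p (fun ω => 3 * (a ω ^ 2 + b ω ^ 2 + d * c ω ^ 2)) ≤
      3 * (A + B + ENNReal.ofReal d * C) := by
  rw [expect_const_mul (by norm_num), expect_add (by exact (ha.pow_const 2).add (hb.pow_const 2))
    (fun ω => by positivity) fun ω => by positivity, expect_add (ha.pow_const 2)
    (fun ω => by positivity) fun ω => by positivity, expect_const_mul hd]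
  norm_num
  gcongr

lemma ofReal_sqrt {x : ℝ} (hx : 0 ≤ x) :
    ENNReal.ofReal √x = ENNReal.ofReal x ^ (1 / 2 : ℝ) := by
  rw [Real.sqrt_eq_rpow, ENNReal.ofReal_rpow_of_nonneg hx (by norm_num)]

lemma three_mul_add_quarter (x y d : ℝ≥0∞) :
    3 * (ENNReal.ofReal (1 ^ 2) * x + ENNReal.ofReal ((1 / 2) ^ 2) * x +
      d * (ENNReal.ofReal ((1 / 2) ^ 2) * y)) = 15 / 4 * x + 3 / 4 * (d * y) := by
  have h0 : (3 : ℝ≥0∞) = ENNReal.ofReal 3 := by simp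
  have h1 : (3 : ℝ≥0∞) * ENNReal.ofReal (1 ^ 2) + 3 * ENNReal.ofReal ((1 / 2) ^ 2) = 15 / 4 := by
    rw [h0, ← ENNReal.ofReal_mul (by norm_num), ← ENNReal.ofReal_mul (by norm_num),
      ← ENNReal.ofReal_add (by norm_num) (by norm_num),
      show (3 * 1 ^ 2 + 3 * (1 / 2) ^ 2 : ℝ) = 15 / 4 by norm_num,
      ENNReal.ofReal_div_of_pos (by norm_num)]
    simp
  have h2 : (3 : ℝ≥0∞) * ENNReal.ofReal ((1 / 2) ^ 2) = 3 / 4 := by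
    rw [h0, ← ENNReal.ofReal_mul (by norm_num), show (3 * (1 / 2) ^ 2 : ℝ) = 3 / 4 by norm_num,
      ENNReal.ofReal_div_of_pos (by norm_num)]
    simp
  rw [← h1, ← h2]
  ring

lemma expect_sq_condE_mul_sum_le (hp : ∀ k, 0 < p k ∧ p k < 1) (N : Finset ℕ)
    {w : Finset ℕ → ℝ} (hw : ∀ S, 0 ≤ w S) {W : ℝ} (hW : ∑ S ∈ N.powerset, w S = W)
    {X Y : PathSpace → ℝ} (hX : Measurable X) (hY : Measurable Y)
    (hXi : Integrable X (law p)) (hYi : Integrable Y (law p)) :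
    expect p (fun ω => (condE p N X ω * ∑ S ∈ N.powerset, w S * condE p S Y ω) ^ 2) ≤
      ENNReal.ofReal (W ^ 2) * (expect p (fun ω => X ω ^ 4) ^ (1 / 2 : ℝ) *
        expect p (fun ω => Y ω ^ 4) ^ (1 / 2 : ℝ)) := by
  have h := expect_sq_sum_condE_mul_sum_le hp {0} N hw hW (X := fun _ => X) (Y := fun _ => Y)
    (fun _ => hX) (fun _ => hY) (fun _ => hXi) (fun _ => hYi)
  simpa only [Finset.sum_singleton, ← pow_add] using h

lemma ite_weight_nonneg (N : Finset ℕ) (l : ℕ) (S : Finset ℕ) :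
    0 ≤ if l ∈ S then weight N S else 0 := by
  split_ifs
  exacts [weight_nonneg N S, le_rfl]

lemma D_condE_eq (hp : ∀ k, 0 < p k ∧ p k < 1) {F : PathSpace → ℝ} (hF : Integrable F (law p))
    (N : Finset ℕ) {k : ℕ} (hk : k ∈ N) : D p k (condE p N F) = condE p N (D p k F) :=
  D_condE_of_mem hp hF hk

lemma D_D_condE_eq (hp : ∀ k, 0 < p k ∧ p k < 1) {F : PathSpace → ℝ} (hF : Integrable F (law p))
    (N : Finset ℕ) {k l : ℕ} (hk : k ∈ N) (hl : l ∈ N) :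
    D p l (D p k (condE p N F)) = condE p N (D p l (D p k F)) := by
  rw [D_condE_of_mem hp hF hk, D_condE_of_mem hp (integrable_D hp hF k) hl]

/-- The product rule splits D_l Z into three sums: the gradient falls on D_k G, on `dInv`, or on
both. The first two yield the same mixed moments after exchanging the roles of the factors; in the
last both factors are second gradients. -/
lemma leading_term_le (hp : ∀ k, 0 < p k ∧ p k < 1) {F : PathSpace → ℝ} (hFm : Measurable F)
    (hF : Integrable F (law p)) (N : Finset ℕ) {Z : PathSpace → ℝ}
    (hZ : Z = fun ω => ∑ k ∈ N, D p k (condE p N F) ω * dInv p N k F ω) :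
    ENNReal.ofReal √(∑ l ∈ N, ∫ ω, D p l Z ω ^ 2 ∂law p) ≤
      (15 / 4 * ∑' (j : ℕ) (k : ℕ) (l : ℕ),
          expect p (fun ω => D p j F ω ^ 2 * D p k F ω ^ 2) ^ (1 / 2 : ℝ) *
            expect p (fun ω => D p l (D p j F) ω ^ 2 * D p l (D p k F) ω ^ 2) ^ (1 / 2 : ℝ))
              ^ (1 / 2 : ℝ)
      + (3 / 4 * ∑' (j : ℕ) (k : ℕ) (l : ℕ), ENNReal.ofReal (1 / pq p l) *
          expect p (fun ω => D p l (D p j F) ω ^ 2 * D p l (D p k F) ω ^ 2)) ^ (1 / 2 : ℝ) := by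
  have dG : DependsOn (condE p N F) (N : Set ℕ) := dependsOn_condE N F
  have dZ : DependsOn Z (N : Set ℕ) :=
    hZ ▸ .sum fun k _ => (dG.D k).comp₂ (· * ·) (dependsOn_dInv N k F)
  have mD (k : ℕ) : Measurable (D p k F) := measurable_D hFm k
  have mDD (l k : ℕ) : Measurable (D p l (D p k F)) := measurable_D (mD k) l
  have iD (k : ℕ) : Integrable (D p k F) (law p) := integrable_D hp hF k
  have iDD (l k : ℕ) : Integrable (D p l (D p k F)) (law p) := integrable_D hp (iD k) l
  set E1 : ℕ → ℕ → ℝ≥0∞ := fun j k =>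
    expect p (fun ω => D p j F ω ^ 2 * D p k F ω ^ 2) ^ (1 / 2 : ℝ)
  set E2 : ℕ → ℕ → ℕ → ℝ≥0∞ := fun j k l =>
    expect p (fun ω => D p l (D p j F) ω ^ 2 * D p l (D p k F) ω ^ 2)
  have hl : ∀ l ∈ N, expect p (fun ω => D p l Z ω ^ 2) ≤
      15 / 4 * ∑ j ∈ N, ∑ k ∈ N, E1 j k * E2 j k l ^ (1 / 2 : ℝ) +
      3 / 4 * (ENNReal.ofReal (1 / pq p l) * ∑ j ∈ N, ∑ k ∈ N, E2 j k l) := by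
    intro l hl
    have hα := expect_sq_sum_condE_mul_sum_le hp N N (weight_nonneg N) (sum_weight N)
      (mDD l) mD (iDD l) iD
    have hβ := expect_sq_sum_condE_mul_sum_le hp N N (ite_weight_nonneg N l) (sum_weight_ite hl)
      mD (mDD l) iD (iDD l)
    have hγ := expect_sq_sum_condE_mul_sum_le hp N N (ite_weight_nonneg N l) (sum_weight_ite hl)
      (mDD l) (mDD l) (iDD l) (iDD l)
    have key := expect_three_mul_add_le (d := 1 / pq p l)
      (Finset.measurable_fun_sum _ fun k _ => measurable_condE.mul
        (Finset.measurable_fun_sum _ fun S _ => measurable_condE.const_mul _))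
      (Finset.measurable_fun_sum _ fun k _ => measurable_condE.mul
        (Finset.measurable_fun_sum _ fun S _ => measurable_condE.const_mul _))
      (one_div_nonneg.2 (pq_pos hp l).le) hα hβ hγ
    refine le_trans (expect_mono fun ω => ?_) (key.trans (le_of_eq ?_))
    · have h1 : D p l Z ω = ∑ k ∈ N, condE p N (D p l (D p k F)) ω * dInv p N k F ω +
          ∑ k ∈ N, condE p N (D p k F) ω * D p l (dInv p N k F) ω -
          sgn p l ω * ∑ k ∈ N, condE p N (D p l (D p k F)) ω * D p l (dInv p N k F) ω := by
        rw [hZ, D_finset_sum, Finset.mul_sum, ← Finset.sum_add_distrib, ← Finset.sum_sub_distrib]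
        refine Finset.sum_congr rfl fun k hk => ?_
        rw [D_mul hp, D_D_condE_eq hp hF N hk hl, D_condE_eq hp hF N hk]
      rw [h1, ← sgn_sq hp l ω]
      simp only [D_dInv hp hF]
      exact sq_add_sub_le _ _ _ _
    · rw [← three_mul_add_quarter]
      congr 3
      · congr 1
        exact Finset.sum_congr rfl fun j _ => Finset.sum_congr rfl fun k _ => mul_comm _ _
      -- In the cross term both factors involve the same second gradients, so the two square roots
      -- multiply to the full moment.
      · simp only [rpow_half_mul_rpow_half]
        rfl
  rw [ofReal_sqrt (Finset.sum_nonneg fun l _ => integral_nonneg fun ω => sq_nonneg _),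
    ENNReal.ofReal_sum_of_nonneg fun l _ => integral_nonneg fun ω => sq_nonneg _]
  refine le_trans (ENNReal.rpow_le_rpow ?_ (by norm_num))
    (ENNReal.rpow_add_le_add_rpow _ _ (by norm_num) (by norm_num))
  calc ∑ l ∈ N, ENNReal.ofReal (∫ ω, D p l Z ω ^ 2 ∂law p)
      ≤ ∑ l ∈ N, (15 / 4 * ∑ j ∈ N, ∑ k ∈ N, E1 j k * E2 j k l ^ (1 / 2 : ℝ) +
      3 / 4 * (ENNReal.ofReal (1 / pq p l) * ∑ j ∈ N, ∑ k ∈ N, E2 j k l)) :=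
        Finset.sum_le_sum fun l h => by
          rw [ofReal_integral_eq_expect ((dZ.D l).comp₁ (· ^ 2)) fun ω => sq_nonneg _]
          exact hl l h
    _ = 15 / 4 * ∑ j ∈ N, ∑ k ∈ N, ∑ l ∈ N, E1 j k * E2 j k l ^ (1 / 2 : ℝ) +
        3 / 4 * ∑ j ∈ N, ∑ k ∈ N, ∑ l ∈ N, ENNReal.ofReal (1 / pq p l) * E2 j k l := by
        rw [Finset.sum_add_distrib, ← Finset.mul_sum, ← Finset.mul_sum]
        simp only [Finset.mul_sum]
        have hswap (f : ℕ → ℕ → ℕ → ℝ≥0∞) :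
            ∑ l ∈ N, ∑ j ∈ N, ∑ k ∈ N, f j k l = ∑ j ∈ N, ∑ k ∈ N, ∑ l ∈ N, f j k l := by
          rw [Finset.sum_comm]
          exact Finset.sum_congr rfl fun j _ => Finset.sum_comm
        exact congrArg₂ (· + ·) (hswap fun j k l => 15 / 4 * (E1 j k * E2 j k l ^ (1 / 2 : ℝ)))
          (hswap fun j k l => 3 / 4 * (ENNReal.ofReal (1 / pq p l) * E2 j k l))
    _ ≤ _ := by
        have htsum (f : ℕ → ℕ → ℕ → ℝ≥0∞) :
            ∑ j ∈ N, ∑ k ∈ N, ∑ l ∈ N, f j k l ≤ ∑' (j : ℕ) (k : ℕ) (l : ℕ), f j k l :=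
          (Finset.sum_le_sum fun j _ => (Finset.sum_le_sum fun k _ =>
            ENNReal.sum_le_tsum N).trans (ENNReal.sum_le_tsum N)).trans (ENNReal.sum_le_tsum N)
        gcongr
        exacts [htsum _, htsum _]

/-- This parallels the leading term with a single index, so the mixed moments become fourth moments.
The absolute value around `dInv` is harmless because taking absolute values contracts gradients. -/
lemma skorohod_term_le (hp : ∀ k, 0 < p k ∧ p k < 1) {F : PathSpace → ℝ} (hFm : Measurable F)
    (hF : Integrable F (law p)) (N : Finset ℕ) {u : ℕ → PathSpace → ℝ}
    (hu : u = fun k ω => 1 / √(pq p k) * (D p k (condE p N F) ω * |dInv p N k F ω|)) :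
    ENNReal.ofReal √(∑ k ∈ N, ∫ ω, u k ω ^ 2 ∂law p +
        ∑ k ∈ N, ∑ l ∈ N, ∫ ω, D p l (u k) ω ^ 2 ∂law p) ≤
      (∑' k : ℕ, ENNReal.ofReal (1 / pq p k) * expect p (fun ω => D p k F ω ^ 4)) ^ (1 / 2 : ℝ)
      + (6 * ∑' (k : ℕ) (l : ℕ), ENNReal.ofReal (1 / pq p k) *
          expect p (fun ω => D p k F ω ^ 4) ^ (1 / 2 : ℝ) *
            expect p (fun ω => D p l (D p k F) ω ^ 4) ^ (1 / 2 : ℝ)) ^ (1 / 2 : ℝ)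
      + (3 * ∑' (k : ℕ) (l : ℕ), ENNReal.ofReal (1 / (pq p k * pq p l)) *
          expect p (fun ω => D p l (D p k F) ω ^ 4)) ^ (1 / 2 : ℝ) := by
  have dG : DependsOn (condE p N F) (N : Set ℕ) := dependsOn_condE N F
  have du (k : ℕ) : DependsOn (u k) (N : Set ℕ) :=
    hu ▸ (dG.D k).comp₂ (fun a b => 1 / √(pq p k) * (a * |b|)) (dependsOn_dInv N k F)
  have mD (k : ℕ) : Measurable (D p k F) := measurable_D hFm k
  have mDD (l k : ℕ) : Measurable (D p l (D p k F)) := measurable_D (mD k) l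
  have iD (k : ℕ) : Integrable (D p k F) (law p) := integrable_D hp hF k
  have iDD (l k : ℕ) : Integrable (D p l (D p k F)) (law p) := integrable_D hp (iD k) l
  have hc0 (k : ℕ) : 0 ≤ 1 / pq p k := one_div_nonneg.2 (pq_pos hp k).le
  have hc (k : ℕ) : (1 / √(pq p k)) ^ 2 = 1 / pq p k := by
    rw [div_pow, one_pow, Real.sq_sqrt (pq_pos hp k).le]
  set E1 : ℕ → ℝ≥0∞ := fun k => expect p (fun ω => D p k F ω ^ 4)
  set E2 : ℕ → ℕ → ℝ≥0∞ := fun k l => expect p (fun ω => D p l (D p k F) ω ^ 4)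
  have h1 : ∀ k ∈ N, expect p (fun ω => u k ω ^ 2) ≤ ENNReal.ofReal (1 / pq p k) * E1 k := by
    intro k hk
    have h := expect_sq_condE_mul_sum_le hp N (weight_nonneg N) (sum_weight N)
      (mD k) (mD k) (iD k) (iD k)
    rw [one_pow, ENNReal.ofReal_one, one_mul, rpow_half_mul_rpow_half] at h
    refine le_trans (le_of_eq ?_) (mul_le_mul_right h (ENNReal.ofReal (1 / pq p k)))
    rw [← expect_const_mul (hc0 k)]
    congr 1
    ext ω
    simp only [hu, D_condE_eq hp hF N hk]
    rw [mul_pow, hc, mul_pow, sq_abs, mul_pow]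
    rfl
  have h2 : ∀ k ∈ N, ∀ l ∈ N, expect p (fun ω => D p l (u k) ω ^ 2) ≤
      6 * (ENNReal.ofReal (1 / pq p k) * E1 k ^ (1 / 2 : ℝ) * E2 k l ^ (1 / 2 : ℝ)) +
      3 * (ENNReal.ofReal (1 / (pq p k * pq p l)) * E2 k l) := by
    intro k hk l hl
    have hα := expect_sq_condE_mul_sum_le hp N (weight_nonneg N) (sum_weight N)
      (mDD l k) (mD k) (iDD l k) (iD k)
    have hβ := expect_sq_condE_mul_sum_le hp N (ite_weight_nonneg N l) (sum_weight_ite hl)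
      (mD k) (mDD l k) (iD k) (iDD l k)
    have hγ := expect_sq_condE_mul_sum_le hp N (ite_weight_nonneg N l) (sum_weight_ite hl)
      (mDD l k) (mDD l k) (iDD l k) (iDD l k)
    have key := expect_three_mul_add_le (d := 1 / pq p l)
      (measurable_condE.mul
        (Finset.measurable_fun_sum _ fun S _ => measurable_condE.const_mul _))
      (measurable_condE.mul
        (Finset.measurable_fun_sum _ fun S _ => measurable_condE.const_mul _))
      (hc0 l) hα hβ hγ
    rw [mul_comm (expect p (fun ω => D p k F ω ^ 4) ^ (1 / 2 : ℝ)), three_mul_add_quarter,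
      rpow_half_mul_rpow_half] at key
    simp only [Pi.mul_apply] at key
    refine le_trans (le_trans (expect_mono (Y := fun ω => 1 / pq p k * _) fun ω => ?_)
      (expect_const_mul (hc0 k)).le) ((mul_le_mul_right key _).trans ?_)
    · have h3 : D p l (u k) ω = 1 / √(pq p k) *
          (condE p N (D p l (D p k F)) ω * |dInv p N k F ω| +
          condE p N (D p k F) ω * D p l (fun ω => |dInv p N k F ω|) ω -
          sgn p l ω * (condE p N (D p l (D p k F)) ω * D p l (fun ω => |dInv p N k F ω|) ω)) := by
        have h := D_mul hp l (D p k (condE p N F)) (fun ω => |dInv p N k F ω|) ω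
        rw [D_D_condE_eq hp hF N hk hl, D_condE_eq hp hF N hk] at h
        rw [← h, hu]
        simp only [D_condE_eq hp hF N hk]
        simp only [D]
        ring
      rw [h3, mul_pow, hc]
      refine mul_le_mul_of_nonneg_left ((sq_add_sub_le _ _ _ _).trans ?_) (hc0 k)
      have h4 : D p l (fun ω => |dInv p N k F ω|) ω ^ 2 ≤ D p l (dInv p N k F) ω ^ 2 :=
        sq_le_sq.2 (abs_D_abs_le l _ ω)
      rw [sgn_sq hp, ← D_dInv hp hF]
      simp only [mul_pow, sq_abs]
      have := hc0 l
      change _ ≤ 3 * (_ * dInv p N k F ω ^ 2 + _ + _)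
      gcongr
    · rw [mul_add]
      refine add_le_add ?_ ?_
      -- The estimate gives 15/4 and 3/4; these are relaxed to the constants 6 and 3 of the bound.
      · calc _ = 15 / 4 * (ENNReal.ofReal (1 / pq p k) * E1 k ^ (1 / 2 : ℝ) *
              E2 k l ^ (1 / 2 : ℝ)) := by simp only [E1, E2]; ring
          _ ≤ _ := by
            gcongr
            rw [ENNReal.div_le_iff (by norm_num) (by norm_num)]
            norm_num
      · calc _ = 3 / 4 * (ENNReal.ofReal (1 / (pq p k * pq p l)) * E2 k l) := by
              rw [← one_div_mul_one_div, ENNReal.ofReal_mul (hc0 k)]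
              simp only [E2]; ring
          _ ≤ _ := by
            gcongr
            rw [ENNReal.div_le_iff (by norm_num) (by norm_num)]
            norm_num
  have h0 (X : PathSpace → ℝ) : 0 ≤ ∫ ω, X ω ^ 2 ∂law p := integral_nonneg fun ω => sq_nonneg _
  have h00 : 0 ≤ ∑ k ∈ N, ∫ ω, u k ω ^ 2 ∂law p := Finset.sum_nonneg fun k _ => h0 _
  have h01 (k : ℕ) : 0 ≤ ∑ l ∈ N, ∫ ω, D p l (u k) ω ^ 2 ∂law p :=
    Finset.sum_nonneg fun l _ => h0 _
  have h02 : 0 ≤ ∑ k ∈ N, ∑ l ∈ N, ∫ ω, D p l (u k) ω ^ 2 ∂law p :=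
    Finset.sum_nonneg fun k _ => h01 k
  rw [ofReal_sqrt (add_nonneg h00 h02), ENNReal.ofReal_add h00 h02,
    ENNReal.ofReal_sum_of_nonneg fun k _ => h0 _, ENNReal.ofReal_sum_of_nonneg fun k _ => h01 k]
  refine le_trans (ENNReal.rpow_le_rpow ?_ (by norm_num))
    ((ENNReal.rpow_add_le_add_rpow _ _ (by norm_num) (by norm_num)).trans
    (add_le_add_left (ENNReal.rpow_add_le_add_rpow _ _ (by norm_num) (by norm_num)) _))
  rw [add_assoc]
  refine add_le_add ?_ ?_
  · refine (Finset.sum_le_sum fun k hk => ?_).trans (ENNReal.sum_le_tsum N)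
    rw [ofReal_integral_eq_expect ((du k).comp₁ (· ^ 2)) fun ω => sq_nonneg _]
    exact h1 k hk
  · calc _ ≤ ∑ k ∈ N, ∑ l ∈ N,
        (6 * (ENNReal.ofReal (1 / pq p k) * E1 k ^ (1 / 2 : ℝ) * E2 k l ^ (1 / 2 : ℝ)) +
        3 * (ENNReal.ofReal (1 / (pq p k * pq p l)) * E2 k l)) := by
          refine Finset.sum_le_sum fun k hk => ?_
          rw [ENNReal.ofReal_sum_of_nonneg fun l _ => h0 _]
          refine Finset.sum_le_sum fun l hl => ?_
          rw [ofReal_integral_eq_expect (((du k).D l).comp₁ (· ^ 2)) fun ω => sq_nonneg _]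
          exact h2 k hk l hl
      _ = 6 * ∑ k ∈ N, ∑ l ∈ N, ENNReal.ofReal (1 / pq p k) * E1 k ^ (1 / 2 : ℝ) *
            E2 k l ^ (1 / 2 : ℝ) +
          3 * ∑ k ∈ N, ∑ l ∈ N, ENNReal.ofReal (1 / (pq p k * pq p l)) * E2 k l := by
          simp only [Finset.sum_add_distrib, Finset.mul_sum]
      _ ≤ _ := by
          have htsum (f : ℕ → ℕ → ℝ≥0∞) :
              ∑ k ∈ N, ∑ l ∈ N, f k l ≤ ∑' (k : ℕ) (l : ℕ), f k l :=
            (Finset.sum_le_sum fun k _ => ENNReal.sum_le_tsum N).trans (ENNReal.sum_le_tsum N)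
          gcongr
          exacts [htsum _, htsum _]

/-! ### Third-order terms: Young and Hölder -/

lemma expect_sq_mul_abs_le {a b : PathSpace → ℝ} (ha : Measurable a) {M : ℝ≥0∞}
    (haM : expect p (fun ω => |a ω| ^ 3) ≤ M) (hbM : expect p (fun ω => |b ω| ^ 3) ≤ M) :
    expect p (fun ω => a ω ^ 2 * |b ω|) ≤ M :=
  calc expect p (fun ω => a ω ^ 2 * |b ω|)
      ≤ expect p (fun ω => 2 / 3 * |a ω| ^ 3 + 1 / 3 * |b ω| ^ 3) := by
        refine expect_mono fun ω => ?_
        rw [← sq_abs]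
        have h1 := abs_nonneg (a ω)
        have h2 := abs_nonneg (b ω)
        -- Young's inequality for exponents 3/2 and 3 via 2a³ + b³ - 3a²b = (a - b)²(2a + b).
        nlinarith [mul_nonneg (sq_nonneg (|a ω| - |b ω|)) (by positivity : 0 ≤ 2 * |a ω| + |b ω|)]
    _ = ENNReal.ofReal (2 / 3) * expect p (fun ω => |a ω| ^ 3) +
          ENNReal.ofReal (1 / 3) * expect p (fun ω => |b ω| ^ 3) := by
        rw [expect_add ((ha.abs.pow_const 3).const_mul _) (fun ω => by positivity)
          fun ω => by positivity, expect_const_mul (by norm_num), expect_const_mul (by norm_num)]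
    _ ≤ ENNReal.ofReal (2 / 3) * M + ENNReal.ofReal (1 / 3) * M := by gcongr
    _ = M := by
        rw [← add_mul, ← ENNReal.ofReal_add (by norm_num) (by norm_num)]
        norm_num

lemma expect_mul_sq_mul_le {a b c : PathSpace → ℝ} (ha : Measurable a) (hb : Measurable b)
    (hc : Measurable c) {r s t : ℝ} (hr : 1 < r) (hs : 1 < s) (ht : 1 < t)
    (hrst : 1 / r + 1 / s + 1 / t = 1) :
    expect p (fun ω => |a ω| * (b ω ^ 2 * |c ω|)) ≤
      expect p (fun ω => |a ω| ^ r) ^ (1 / r) * expect p (fun ω => |b ω| ^ (2 * s)) ^ (1 / s) *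
        expect p (fun ω => |c ω| ^ t) ^ (1 / t) := by
  have hr0 : 0 < r := by linarith
  have hs0 : 0 < s := by linarith
  have ht0 : 0 < t := by linarith
  have h := ENNReal.lintegral_prod_norm_pow_le (μ := law p) Finset.univ
    (f := ![fun ω => ‖a ω‖ₑ ^ r, fun ω => ‖b ω‖ₑ ^ (2 * s), fun ω => ‖c ω‖ₑ ^ t])
    (p := ![1 / r, 1 / s, 1 / t])
    (by
      intro i _
      fin_cases i
      exacts [(ha.enorm.pow_const r).aemeasurable, (hb.enorm.pow_const _).aemeasurable,
        (hc.enorm.pow_const t).aemeasurable])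
    (by simpa [Fin.sum_univ_three] using hrst)
    (by
      intro i _
      fin_cases i <;> simp <;> positivity)
  simp only [Fin.prod_univ_three, Matrix.cons_val_zero, Matrix.cons_val_one, Matrix.cons_val,
    ← ENNReal.rpow_mul] at h
  rw [mul_one_div_cancel hr0.ne', mul_one_div_cancel ht0.ne',
    show 2 * s * (1 / s) = 2 by field_simp] at h
  simp only [expect, ofReal_abs_rpow _ hr0.le, ofReal_abs_rpow _ ht0.le,
    ofReal_abs_rpow _ (by positivity : 0 ≤ 2 * s)]
  refine le_trans (le_of_eq (lintegral_congr fun ω => ?_)) h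
  rw [ENNReal.rpow_one, ENNReal.rpow_one, ENNReal.rpow_two,
    ENNReal.ofReal_mul (abs_nonneg _), ENNReal.ofReal_mul (sq_nonneg _), ofReal_sq,
    Real.enorm_eq_ofReal_abs (a ω), Real.enorm_eq_ofReal_abs (c ω), mul_assoc]

/-! ### Assembly of the bound for finitely many coordinates -/

/-- The right-hand side of the Berry-Esseen bound. -/
def berryEsseenBound (p : ℕ → I) (F : PathSpace → ℝ) (r s t : ℝ) : ℝ≥0∞ :=
  (15 / 4 * ∑' (j : ℕ) (k : ℕ) (l : ℕ),
      expect p (fun ω => D p j F ω ^ 2 * D p k F ω ^ 2) ^ (1 / 2 : ℝ) *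
        expect p (fun ω => D p l (D p j F) ω ^ 2 * D p l (D p k F) ω ^ 2) ^ (1 / 2 : ℝ)) ^ (1 / 2 : ℝ)
  + (3 / 4 * ∑' (j : ℕ) (k : ℕ) (l : ℕ), ENNReal.ofReal (1 / pq p l) *
      expect p (fun ω => D p l (D p j F) ω ^ 2 * D p l (D p k F) ω ^ 2)) ^ (1 / 2 : ℝ)
  + ENNReal.ofReal (√(2 * Real.pi) / 8) *
      ∑' k : ℕ, ENNReal.ofReal (1 / √(pq p k)) * expect p (fun ω => |D p k F ω| ^ 3)
  + 1 / 2 * expect p (fun ω => |F ω| ^ r) ^ (1 / r) *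
      ∑' k : ℕ, ENNReal.ofReal (1 / √(pq p k)) *
        expect p (fun ω => |D p k F ω| ^ (2 * s)) ^ (1 / s) * expect p (fun ω => |D p k F ω| ^ t) ^ (1 / t)
  + (∑' k : ℕ, ENNReal.ofReal (1 / pq p k) * expect p (fun ω => D p k F ω ^ 4)) ^ (1 / 2 : ℝ)
  + (6 * ∑' (k : ℕ) (l : ℕ), ENNReal.ofReal (1 / pq p k) *
      expect p (fun ω => D p k F ω ^ 4) ^ (1 / 2 : ℝ) *
        expect p (fun ω => D p l (D p k F) ω ^ 4) ^ (1 / 2 : ℝ)) ^ (1 / 2 : ℝ)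
  + (3 * ∑' (k : ℕ) (l : ℕ), ENNReal.ofReal (1 / (pq p k * pq p l)) *
      expect p (fun ω => D p l (D p k F) ω ^ 4)) ^ (1 / 2 : ℝ)

lemma expect_congr_ae {X Y : PathSpace → ℝ} (h : X =ᵐ[law p] Y) : expect p X = expect p Y :=
  lintegral_congr_ae (h.mono fun ω hω => by simp only [hω])

lemma berryEsseenBound_congr_ae (hp : ∀ k, 0 < p k ∧ p k < 1) {F F' : PathSpace → ℝ}
    (h : F =ᵐ[law p] F') (r s t : ℝ) : berryEsseenBound p F r s t = berryEsseenBound p F' r s t := by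
  have hD (k : ℕ) := D_congr_ae hp h k
  have hDD (l k : ℕ) := D_congr_ae hp (hD k) l
  have e0 (q : ℝ) : expect p (fun ω => |F ω| ^ q) = expect p (fun ω => |F' ω| ^ q) :=
    expect_congr_ae (h.fun_comp (|·| ^ q))
  have e1 (q : ℝ) (k : ℕ) : expect p (fun ω => |D p k F ω| ^ q) =
      expect p (fun ω => |D p k F' ω| ^ q) := expect_congr_ae ((hD k).fun_comp (|·| ^ q))
  have e2 (q : ℕ) (k : ℕ) : expect p (fun ω => |D p k F ω| ^ q) =
      expect p (fun ω => |D p k F' ω| ^ q) := expect_congr_ae ((hD k).fun_comp (|·| ^ q))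
  have e3 (q : ℕ) (k : ℕ) : expect p (fun ω => D p k F ω ^ q) =
      expect p (fun ω => D p k F' ω ^ q) := expect_congr_ae ((hD k).fun_comp (· ^ q))
  have e4 (q : ℕ) (l k : ℕ) : expect p (fun ω => D p l (D p k F) ω ^ q) =
      expect p (fun ω => D p l (D p k F') ω ^ q) := expect_congr_ae ((hDD l k).fun_comp (· ^ q))
  have e5 (j k : ℕ) : expect p (fun ω => D p j F ω ^ 2 * D p k F ω ^ 2) =
      expect p (fun ω => D p j F' ω ^ 2 * D p k F' ω ^ 2) :=
    expect_congr_ae (((hD j).fun_comp (· ^ 2)).mul ((hD k).fun_comp (· ^ 2)))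
  have e6 (l j k : ℕ) : expect p (fun ω => D p l (D p j F) ω ^ 2 * D p l (D p k F) ω ^ 2) =
      expect p (fun ω => D p l (D p j F') ω ^ 2 * D p l (D p k F') ω ^ 2) :=
    expect_congr_ae (((hDD l j).fun_comp (· ^ 2)).mul ((hDD l k).fun_comp (· ^ 2)))
  simp only [berryEsseenBound, e0, e1, e2, e3, e4, e5, e6]

/-- The Berry-Esseen bound for the projection of `F` to finitely many coordinates, in which the
distance of the variance to one enters as an additional error. -/
lemma ofReal_abs_integral_condE_sub_Φ_le (hp : ∀ k, 0 < p k ∧ p k < 1) {F : PathSpace → ℝ}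
    (hFm : Measurable F) (hF : Integrable F (law p)) (hF0 : ∫ ω, F ω ∂law p = 0)
    {r s t : ℝ} (hr : 1 < r) (hs : 1 < s) (ht : 1 < t) (hrst : 1 / r + 1 / s + 1 / t = 1)
    (N : Finset ℕ) (x : ℝ) :
    ENNReal.ofReal |∫ ω, (if condE p N F ω ≤ x then 1 else 0) ∂law p - Φ x| ≤
      ENNReal.ofReal |1 - ∫ ω, condE p N F ω ^ 2 ∂law p| + berryEsseenBound p F r s t := by
  have dG : DependsOn (condE p N F) (N : Set ℕ) := dependsOn_condE N F
  have dA (k : ℕ) : DependsOn (dInv p N k F) (N : Set ℕ) := dependsOn_dInv N k F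
  have mD (k : ℕ) : Measurable (D p k F) := measurable_D hFm k
  have d1 (k : ℕ) : DependsOn (fun ω => D p k (condE p N F) ω ^ 2 * |dInv p N k F ω|)
      (N : Set ℕ) := (dG.D k).comp₂ (fun a b => a ^ 2 * |b|) (dA k)
  have d2 (k : ℕ) : DependsOn (fun ω => |condE p N F ω| *
      (D p k (condE p N F) ω ^ 2 * |dInv p N k F ω|)) (N : Set ℕ) :=
    dG.comp₂ (fun a b => |a| * b) (d1 k)
  have hc (k : ℕ) : 0 ≤ 1 / √(pq p k) := by positivity
  have p1 (k : ℕ) (ω : PathSpace) : 0 ≤ D p k (condE p N F) ω ^ 2 * |dInv p N k F ω| := by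
    positivity
  have p2 (k : ℕ) (ω : PathSpace) : 0 ≤ |condE p N F ω| *
      (D p k (condE p N F) ω ^ 2 * |dInv p N k F ω|) := by positivity
  have n1 (k : ℕ) : 0 ≤ 1 / √(pq p k) *
      ∫ ω, D p k (condE p N F) ω ^ 2 * |dInv p N k F ω| ∂law p :=
    mul_nonneg (hc k) (integral_nonneg (p1 k))
  have n2 (k : ℕ) : 0 ≤ 1 / √(pq p k) * ∫ ω, |condE p N F ω| *
      (D p k (condE p N F) ω ^ 2 * |dInv p N k F ω|) ∂law p :=
    mul_nonneg (hc k) (integral_nonneg (p2 k))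
  have h3 : ENNReal.ofReal (√(2 * Real.pi) / 8 * ∑ k ∈ N, 1 / √(pq p k) *
        ∫ ω, D p k (condE p N F) ω ^ 2 * |dInv p N k F ω| ∂law p) ≤
      ENNReal.ofReal (√(2 * Real.pi) / 8) *
        ∑' k : ℕ, ENNReal.ofReal (1 / √(pq p k)) * expect p (fun ω => |D p k F ω| ^ 3) := by
    rw [ENNReal.ofReal_mul (by positivity), ENNReal.ofReal_sum_of_nonneg fun k _ => n1 k]
    gcongr
    refine (Finset.sum_le_sum fun k hk => ?_).trans (ENNReal.sum_le_tsum N)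
    rw [ENNReal.ofReal_mul (hc k), ofReal_integral_eq_expect (d1 k) (p1 k)]
    gcongr
    have h := expect_condE_rpow_le (p := p) (mD k) N (t := (3 : ℕ)) (by norm_num)
    have h' := expect_dInv_rpow_le (p := p) hFm N k (t := (3 : ℕ)) (by norm_num)
    simp only [Real.rpow_natCast] at h h'
    rw [← D_condE_eq hp hF N hk] at h
    exact expect_sq_mul_abs_le (dG.D k).measurable h h'
  have h4 : ENNReal.ofReal (1 / 2 * ∑ k ∈ N, 1 / √(pq p k) *
        ∫ ω, |condE p N F ω| * (D p k (condE p N F) ω ^ 2 * |dInv p N k F ω|) ∂law p) ≤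
      1 / 2 * expect p (fun ω => |F ω| ^ r) ^ (1 / r) *
      ∑' k : ℕ, ENNReal.ofReal (1 / √(pq p k)) *
        expect p (fun ω => |D p k F ω| ^ (2 * s)) ^ (1 / s) *
          expect p (fun ω => |D p k F ω| ^ t) ^ (1 / t) := by
    rw [ENNReal.ofReal_mul (by positivity), ENNReal.ofReal_sum_of_nonneg fun k _ => n2 k,
      mul_assoc, ENNReal.ofReal_div_of_pos two_pos, ENNReal.ofReal_one, ENNReal.ofReal_ofNat,
      ← ENNReal.tsum_mul_left]
    gcongr
    refine (Finset.sum_le_sum fun k hk => ?_).trans (ENNReal.sum_le_tsum N)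
    rw [ENNReal.ofReal_mul (hc k), ofReal_integral_eq_expect (d2 k) (p2 k)]
    have h := expect_mul_sq_mul_le (p := p) dG.measurable (dG.D (p := p) k).measurable
      (dA k).measurable hr hs ht hrst
    have hD := expect_condE_rpow_le (p := p) (mD k) N (t := 2 * s) (by linarith)
    rw [← D_condE_eq hp hF N hk] at hD
    calc _ ≤ ENNReal.ofReal (1 / √(pq p k)) * (expect p (fun ω => |F ω| ^ r) ^ (1 / r) *
          expect p (fun ω => |D p k F ω| ^ (2 * s)) ^ (1 / s) *
            expect p (fun ω => |D p k F ω| ^ t) ^ (1 / t)) := by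
          gcongr
          refine h.trans ?_
          gcongr
          exacts [expect_condE_rpow_le hFm N hr.le, expect_dInv_rpow_le hFm N k ht.le]
      _ = _ := by ring
  refine (ENNReal.ofReal_le_ofReal
    (abs_integral_sub_Φ_le hp hF hF0 x (N := N) rfl rfl rfl)).trans ?_
  have a3 : 0 ≤ √(2 * Real.pi) / 8 * ∑ k ∈ N, 1 / √(pq p k) *
      ∫ ω, D p k (condE p N F) ω ^ 2 * |dInv p N k F ω| ∂law p :=
    mul_nonneg (by positivity) (Finset.sum_nonneg fun k _ => n1 k)
  have a4 : 0 ≤ 1 / 2 * ∑ k ∈ N, 1 / √(pq p k) *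
      ∫ ω, |condE p N F ω| * (D p k (condE p N F) ω ^ 2 * |dInv p N k F ω|) ∂law p :=
    mul_nonneg (by positivity) (Finset.sum_nonneg fun k _ => n2 k)
  rw [ENNReal.ofReal_add (by positivity) (by positivity),
    ENNReal.ofReal_add (by positivity) (by positivity),
    ENNReal.ofReal_add (by positivity) (by positivity),
    ENNReal.ofReal_add (by positivity) (by positivity)]
  calc _ ≤ _ := add_le_add (add_le_add (add_le_add (add_le_add le_rfl
        (leading_term_le hp hFm hF N rfl)) h3) h4) (skorohod_term_le hp hFm hF N rfl)
    _ = _ := by unfold berryEsseenBound; ring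

open Filter Topology

/-! ### Passage to infinitely many coordinates -/

lemma integrable_condE {S : Finset ℕ} {X : PathSpace → ℝ} : Integrable (condE p S X) (law p) :=
  (dependsOn_condE S X).integrable

lemma measurable_piLE_of_dependsOn {n : ℕ} {X : PathSpace → ℝ}
    (hX : DependsOn X (Set.Iic n)) : Measurable[Filtration.piLE (X := fun _ : ℕ => ℤˣ) n] X := by
  obtain ⟨g, rfl⟩ := dependsOn_iff_exists_comp.1 hX
  have : Countable (∀ _ : Set.Iic n, ℤˣ) := by
    have : Finite (∀ _ : Set.Iic n, ℤˣ) := inferInstance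
    infer_instance
  exact (measurable_of_countable g).comp (comap_measurable _)

/-- An event determined by the first coordinates has an indicator unaffected by resampling the
others, so it factors out of the average. This identifies `condE` with the martingale to which
Lévy's convergence theorem applies. -/
lemma condE_Iic_ae_eq_condExp {F : PathSpace → ℝ} (hF : Integrable F (law p)) (n : ℕ) :
    condE p (Finset.Iic n) F =ᵐ[law p]
      (law p)[F | Filtration.piLE (X := fun _ : ℕ => ℤˣ) n] := by
  have hd := dependsOn_condE (p := p) (Finset.Iic n) F
  refine ae_eq_condExp_of_forall_setIntegral_eq (Filtration.le _ n) hF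
    (fun s _ _ => integrable_condE.integrableOn) (fun s hs _ => ?_) ?_
  · have hsm := Filtration.le _ n s hs
    have hsd : DependsOn (s.indicator (1 : PathSpace → ℝ)) (Finset.Iic n : Set ℕ) := by
      rw [Finset.coe_Iic]
      obtain ⟨A, -, rfl⟩ := hs
      intro ω ω' h
      have h' : Preorder.restrictLe (π := fun _ : ℕ => ℤˣ) n ω = Preorder.restrictLe n ω' :=
        funext fun i => h i i.2
      have hiff : ω ∈ Preorder.restrictLe n ⁻¹' A ↔ ω' ∈ Preorder.restrictLe n ⁻¹' A :=
        iff_of_eq (congrArg (· ∈ A) h')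
      by_cases hA : ω' ∈ Preorder.restrictLe n ⁻¹' A
      · rw [Set.indicator_of_mem hA, Set.indicator_of_mem (hiff.2 hA)]
        rfl
      · rw [Set.indicator_of_notMem hA, Set.indicator_of_notMem (mt hiff.1 hA)]
    rw [← integral_indicator hsm, ← integral_indicator hsm]
    have hi : Integrable (s.indicator F) (law p) := hF.indicator hsm
    have hi' := (measurePreserving_piecewise (p := p) (Finset.Iic n)).integrable_comp_of_integrable hi
    have h1 : ∫ ω, s.indicator F ω ∂law p =
        ∫ ω, ∫ ω', s.indicator F ((Finset.Iic n).piecewise ω ω') ∂law p ∂law p := by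
      rw [← integral_prod (fun z : PathSpace × PathSpace =>
        s.indicator F ((Finset.Iic n).piecewise z.1 z.2)) hi',
        ← integral_map (measurable_piecewise _).aemeasurable
          (by
            rw [(measurePreserving_piecewise (p := p) (Finset.Iic n)).map_eq]
            exact hi.aestronglyMeasurable),
        (measurePreserving_piecewise (p := p) (Finset.Iic n)).map_eq]
    rw [h1]
    refine integral_congr_ae (.of_forall fun ω => ?_)
    have h2 (ω' : PathSpace) : s.indicator F ((Finset.Iic n).piecewise ω ω') =
        s.indicator 1 ω * F ((Finset.Iic n).piecewise ω ω') := by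
      rw [← hsd (x := (Finset.Iic n).piecewise ω ω') (y := ω) fun i hi =>
        Finset.piecewise_eq_of_mem _ _ _ hi]
      by_cases h : (Finset.Iic n).piecewise ω ω' ∈ s <;> simp [h]
    simp only [h2]
    rw [integral_const_mul]
    by_cases h : ω ∈ s <;> simp [h, condE]
  · rw [Finset.coe_Iic] at hd
    exact (measurable_piLE_of_dependsOn hd).stronglyMeasurable.aestronglyMeasurable

lemma pi_le_iSup_piLE : (MeasurableSpace.pi : MeasurableSpace PathSpace) ≤
    ⨆ n, Filtration.piLE (X := fun _ : ℕ => ℤˣ) n := by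
  refine iSup_le fun i => le_trans ?_ (le_iSup _ i)
  rintro _ ⟨A, hA, rfl⟩
  have h : Measurable fun f : (Set.Iic i → ℤˣ) => f ⟨i, Set.mem_Iic.2 le_rfl⟩ :=
    measurable_pi_apply _
  exact ⟨_, h hA, rfl⟩

lemma tendsto_condE_Iic {F : PathSpace → ℝ}
    (hFm : Measurable F) (hF : Integrable F (law p)) :
    ∀ᵐ ω ∂law p, Tendsto (fun n => condE p (Finset.Iic n) F ω) atTop (𝓝 (F ω)) := by
  have h1 := hF.tendsto_ae_condExp (ℱ := Filtration.piLE (X := fun _ : ℕ => ℤˣ))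
    (Measurable.stronglyMeasurable (hFm.mono pi_le_iSup_piLE le_rfl))
  have h2 := ae_all_iff.2 fun n => condE_Iic_ae_eq_condExp hF n
  filter_upwards [h1, h2] with ω h1 h2
  exact h1.congr fun n => (h2 n).symm

/-- Second moments of the projections are at most 1 by contraction, and their lower limit is at
least 1 by almost sure convergence and Fatou's lemma. -/
lemma eventually_abs_one_sub_le {F : PathSpace → ℝ}
    (hFm : Measurable F) (hF : MemLp F 2 (law p)) (hvar : ∫ ω, F ω ^ 2 ∂law p = 1) {δ : ℝ}
    (hδ : 0 < δ) :
    ∀ᶠ n in atTop, |1 - ∫ ω, condE p (Finset.Iic n) F ω ^ 2 ∂law p| ≤ δ := by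
  have hE : expect p (fun ω => F ω ^ 2) = 1 := by
    rw [expect, ← ofReal_integral_eq_lintegral_ofReal hF.integrable_sq
      (.of_forall fun ω => sq_nonneg _), hvar, ENNReal.ofReal_one]
  have hn (n : ℕ) : ENNReal.ofReal (∫ ω, condE p (Finset.Iic n) F ω ^ 2 ∂law p) =
      expect p (fun ω => condE p (Finset.Iic n) F ω ^ 2) :=
    ofReal_integral_eq_expect ((dependsOn_condE _ F).comp₁ (· ^ 2)) fun ω => sq_nonneg _
  have h0 (n : ℕ) : 0 ≤ ∫ ω, condE p (Finset.Iic n) F ω ^ 2 ∂law p :=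
    integral_nonneg fun ω => sq_nonneg _
  have hup (n : ℕ) : ∫ ω, condE p (Finset.Iic n) F ω ^ 2 ∂law p ≤ 1 := by
    have := expect_condE_rpow_le (p := p) hFm (Finset.Iic n) one_le_two
    simp only [Real.rpow_two, sq_abs] at this
    rwa [hE, ← hn, ENNReal.ofReal_le_one] at this
  have hlim : 1 ≤ liminf (fun n => expect p (fun ω => condE p (Finset.Iic n) F ω ^ 2)) atTop := by
    rw [← hE]
    refine le_trans (lintegral_mono_ae ?_) (lintegral_liminf_le fun n =>
      (measurable_condE.pow_const 2).ennreal_ofReal)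
    filter_upwards [tendsto_condE_Iic hFm (hF.integrable one_le_two)] with ω hω
    exact (ENNReal.tendsto_ofReal (hω.pow 2)).liminf_eq.ge
  have hlt : ENNReal.ofReal (1 - δ) <
      liminf (fun n => expect p (fun ω => condE p (Finset.Iic n) F ω ^ 2)) atTop :=
    lt_of_lt_of_le (by rw [ENNReal.ofReal_lt_one]; linarith) hlim
  filter_upwards [eventually_lt_of_lt_liminf hlt] with n h
  rw [← hn, ENNReal.ofReal_lt_ofReal_iff'] at h
  rw [abs_of_nonneg (sub_nonneg.2 (hup n))]
  linarith [h.1]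

lemma eventually_measureReal_abs_sub_le {F : PathSpace → ℝ}
    (hFm : Measurable F) (hF : Integrable F (law p)) {ε δ : ℝ} (hε : 0 < ε) (hδ : 0 < δ) :
    ∀ᶠ n in atTop, (law p).real {ω | ε ≤ |condE p (Finset.Iic n) F ω - F ω|} ≤ δ := by
  have h := tendstoInMeasure_iff_measureReal_dist.1 (tendstoInMeasure_of_tendsto_ae
    (fun n => integrable_condE.aestronglyMeasurable) (tendsto_condE_Iic hFm hF)) ε hε
  exact h.eventually (eventually_le_nhds hδ)

lemma integral_ite_le_eq {G : PathSpace → ℝ} (hG : Measurable G) (x : ℝ) :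
    ∫ ω, (if G ω ≤ x then (1 : ℝ) else 0) ∂law p = (law p).real {ω | G ω ≤ x} := by
  rw [← integral_indicator_one (measurableSet_le hG measurable_const)]
  rfl

/-- Sandwich the distribution function of `F` between those of a projection at x ± ε/2, up to the
probability that the two differ by ε/2. The three errors of size δ/3 are this probability, the
variance defect and the oscillation of Φ near `x`. -/
lemma abs_measureReal_sub_Φ_le (hp : ∀ k, 0 < p k ∧ p k < 1) {F : PathSpace → ℝ}
    (hFm : Measurable F) (hF : MemLp F 2 (law p)) (hF0 : ∫ ω, F ω ∂law p = 0)
    (hvar : ∫ ω, F ω ^ 2 ∂law p = 1)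
    {r s t : ℝ} (hr : 1 < r) (hs : 1 < s) (ht : 1 < t) (hrst : 1 / r + 1 / s + 1 / t = 1)
    (hB : berryEsseenBound p F r s t ≠ ∞) (x : ℝ) :
    |(law p).real {ω | F ω ≤ x} - Φ x| ≤ (berryEsseenBound p F r s t).toReal := by
  set b := (berryEsseenBound p F r s t).toReal
  have hFi : Integrable F (law p) := hF.integrable one_le_two
  have hfin (n : ℕ) (y : ℝ) : |(law p).real {ω | condE p (Finset.Iic n) F ω ≤ y} - Φ y| ≤
      |1 - ∫ ω, condE p (Finset.Iic n) F ω ^ 2 ∂law p| + b := by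
    have h := ofReal_abs_integral_condE_sub_Φ_le hp hFm hFi hF0 hr hs ht hrst (Finset.Iic n) y
    rw [integral_ite_le_eq measurable_condE, ← ENNReal.ofReal_toReal hB,
      ← ENNReal.ofReal_add (abs_nonneg _) ENNReal.toReal_nonneg,
      ENNReal.ofReal_le_ofReal_iff (by positivity)] at h
    exact h
  refine le_of_forall_pos_le_add fun δ hδ => ?_
  have hδ3 : 0 < δ / 3 := by positivity
  obtain ⟨ε, hε, hcont⟩ := Metric.continuousAt_iff.1 (continuous_Φ.continuousAt (x := x)) _ hδ3
  have hε2 : 0 < ε / 2 := by positivity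
  obtain ⟨n, hn1, hn2⟩ := ((eventually_abs_one_sub_le hFm hF hvar hδ3).and
    (eventually_measureReal_abs_sub_le hFm hFi hε2 hδ3)).exists
  set G := condE p (Finset.Iic n) F
  have hup : (law p).real {ω | F ω ≤ x} ≤ (law p).real {ω | G ω ≤ x + ε / 2} +
      (law p).real {ω | ε / 2 ≤ |G ω - F ω|} := by
    refine (measureReal_mono fun ω hω => ?_).trans (measureReal_union_le _ _)
    by_cases h : ε / 2 ≤ |G ω - F ω|
    · exact Or.inr h
    · refine Or.inl ?_
      have := (abs_lt.1 (not_le.1 h)).2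
      simp only [Set.mem_ofPred_eq] at hω ⊢
      linarith
  have hlo : (law p).real {ω | G ω ≤ x - ε / 2} ≤ (law p).real {ω | F ω ≤ x} +
      (law p).real {ω | ε / 2 ≤ |G ω - F ω|} := by
    refine (measureReal_mono fun ω hω => ?_).trans (measureReal_union_le _ _)
    by_cases h : ε / 2 ≤ |G ω - F ω|
    · exact Or.inr h
    · refine Or.inl ?_
      have := (abs_lt.1 (not_le.1 h)).1
      simp only [Set.mem_ofPred_eq] at hω ⊢
      linarith
  have h1 := abs_le.1 (hfin n (x + ε / 2))
  have h2 := abs_le.1 (hfin n (x - ε / 2))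
  have h3 := abs_lt.1 (hcont (x := x + ε / 2) (by
    rw [Real.dist_eq, add_sub_cancel_left, abs_of_pos hε2]; linarith))
  have h4 := abs_lt.1 (hcont (x := x - ε / 2) (by
    rw [Real.dist_eq, sub_sub_cancel_left, abs_neg, abs_of_pos hε2]; linarith))
  rw [abs_le]
  constructor
  · linarith [h2.1, h4.1]
  · linarith [h1.2, h3.2]

end Rademacher

end

/-! ### The theorem for a general representative -/

theorem theorem4p2 (p : ℕ → I) (hp : ∀ k, 0 < p k ∧ p k < 1)
    (F : PathSpace → ℝ) (hF : MemDomD p F)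
    (hF_mean : ∫ ω, F ω ∂(law p) = 0)
    (hF_var : ∫ ω, F ω ^ 2 ∂(law p) = 1)
    {Ω : Type*} [MeasurableSpace Ω] (ν : Measure Ω) (N : Ω → ℝ)
    (hN : HasLaw N (gaussianReal 0 1) ν)
    (r s t : ℝ) (hr : 1 < r) (hs : 1 < s) (ht : 1 < t) (hrst : 1 / r + 1 / s + 1 / t = 1) :
    ENNReal.ofReal (kolmogorovDist F (law p) N ν) ≤
      (15 / 4 * ∑' (j : ℕ) (k : ℕ) (l : ℕ),
          expect p (fun ω => D p j F ω ^ 2 * D p k F ω ^ 2) ^ (1 / 2 : ℝ) *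
            expect p (fun ω => D p l (D p j F) ω ^ 2 * D p l (D p k F) ω ^ 2) ^ (1 / 2 : ℝ)) ^ (1 / 2 : ℝ)
      + (3 / 4 * ∑' (j : ℕ) (k : ℕ) (l : ℕ), ENNReal.ofReal (1 / pq p l) *
          expect p (fun ω => D p l (D p j F) ω ^ 2 * D p l (D p k F) ω ^ 2)) ^ (1 / 2 : ℝ)
      + ENNReal.ofReal (√(2 * Real.pi) / 8) *
          ∑' k : ℕ, ENNReal.ofReal (1 / √(pq p k)) * expect p (fun ω => |D p k F ω| ^ 3)
      + 1 / 2 * expect p (fun ω => |F ω| ^ r) ^ (1 / r) *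
          ∑' k : ℕ, ENNReal.ofReal (1 / √(pq p k)) *
            expect p (fun ω => |D p k F ω| ^ (2 * s)) ^ (1 / s) * expect p (fun ω => |D p k F ω| ^ t) ^ (1 / t)
      + (∑' k : ℕ, ENNReal.ofReal (1 / pq p k) * expect p (fun ω => D p k F ω ^ 4)) ^ (1 / 2 : ℝ)
      + (6 * ∑' (k : ℕ) (l : ℕ), ENNReal.ofReal (1 / pq p k) *
          expect p (fun ω => D p k F ω ^ 4) ^ (1 / 2 : ℝ) *
            expect p (fun ω => D p l (D p k F) ω ^ 4) ^ (1 / 2 : ℝ)) ^ (1 / 2 : ℝ)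
      + (3 * ∑' (k : ℕ) (l : ℕ), ENNReal.ofReal (1 / (pq p k * pq p l)) *
          expect p (fun ω => D p l (D p k F) ω ^ 4)) ^ (1 / 2 : ℝ) := by
  change _ ≤ berryEsseenBound p F r s t
  -- Both sides depend only on the almost-everywhere class of `F`, so a measurable representative
  -- may be used.
  obtain ⟨F', hFm', hFF'⟩ := hF.1.1
  have hFm : Measurable F' := hFm'.measurable
  rw [berryEsseenBound_congr_ae hp hFF']
  -- An infinite bound is trivial; a finite one can be compared in the reals, for each `x`
  -- separately.
  by_cases hB : berryEsseenBound p F' r s t = ∞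
  · rw [hB]; exact le_top
  rw [← ENNReal.ofReal_toReal hB]
  refine ENNReal.ofReal_le_ofReal (ciSup_le fun x => ?_)
  have h1 : (law p).real {ω | F ω ≤ x} = (law p).real {ω | F' ω ≤ x} :=
    measureReal_congr (hFF'.mono fun ω hω => by
      change (F ω ≤ x) = (F' ω ≤ x)
      rw [hω])
  have h2 : ν.real {ω | N ω ≤ x} = StdNormal.Φ x := by
    rw [StdNormal.Φ, cdf_eq_real]
    exact hN.measureReal_eq (p := (· ≤ x)) measurableSet_Iic
  rw [h1, h2]
  refine abs_measureReal_sub_Φ_le hp hFm (hF.1.ae_eq hFF') ?_ ?_ hr hs ht hrst hB x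
  · rw [← integral_congr_ae hFF', hF_mean]
  · exact (integral_congr_ae (hFF'.fun_comp (· ^ 2))).symm.trans hF_var
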